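/- Let $A$ and $S$ be positive random variables (i.e. $P(A>0)=P(S>0)=1$) with finite means, and let $n\ge 1$. For such a random variable $X$ let $R(X)$ be its residual life, $P(R(X)>z)=\mathbb E[X]^{-1}\int_z^\infty P(X>y)\,dy$ for $z\ge 0$. An equilibrium renewal process with renewal distribution $X$ counts the events in $[0,t]$ when all inter-event times are independent, the first is distributed as $R(X)$ and all later ones as $X$. Let $A(t)$, $N_1(t),\dots,N_n(t)$ be independent equilibrium renewal processes, $A(t)$ with renewal distribution $A$ and each $N_i(t)$ with renewal distribution $S$. Let $U^1$ be the first inter-event time of $A(t)$ and $V_i^1$ that of $N_i(t)$. Let $Q(t)$ be the number of jobs in system (in service or waiting) at time $t$ in the first-come-first-served $GI/GI/n$ queue in which, at time $0$, each server $i=1,\dots,n$ holds exactly one job, with remaining processing time $V_i^1$, and no job is waiting; the arrivals are the events of $A(t)$ (so the first inter-arrival time is $U^1$ and the later ones are i.i.d. distributed as $A$); and the processing times of the arriving jobs are i.i.d. distributed as $S$, independent of the arrivals and of $(V_i^1)_i$. Then for all real $t,x\ge 0$, $P(Q(t)>x)$ is at most $$\inf_{\substack{\delta\in[0,t]\\ \eta\in\{0,\dots,n\}}}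 P\Bigg(\max\bigg(1+\sup_{0\le s\le\delta}\Big(A(s)-\sum_{i=1}^{\eta}N_i(s)\Big),\ \sup_{\delta\le s\le t}\Big(A(s)-\sum_{i=1}^{n}N_i(s)\Big)+\sum_{i=\eta+1}^{n}N_i(\delta)\bigg)+\sum_{i=\eta+1}^{n}I\big(N_i(\delta)=0\big)>x-\eta\Bigg).$$ If in addition $Q(t)$ converges weakly to a random variable $Q(\infty)$ as $t\to\infty$, then for all $x>0$, $P(Q(\infty)>x)$ is at most $$\inf_{\substack{\delta\ge 0\\ \eta\in\{0,\dots,n\}}} P\Bigg(\max\bigg(1+\sup_{0\le s\le\delta}\Big(A(s)-\sum_{i=1}^{\eta}N_i(s)\Big),\ \sup_{s\ge\delta}\Big(A(s)-\sum_{i=1}^{n}N_i(s)\Big)+\sum_{i=\eta+1}^{n}N_i(\delta)\bigg)+\sum_{i=\eta+1}^{n}I\big(N_i(\delta)=0\big)>x-\eta\Bigg),$$ where the supremum over $s\ge\delta$ may be $+\infty$. -/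

import Mathlib

open MeasureTheory ProbabilityTheory Filter Set

noncomputable section

/-! ### Renewal processes -/

/-- The residual life distribution `R(X)` of a positive random variable `X` with law `ν` and finite
mean: it has density `P(X > y) / E[X]` on `[0, ∞)`, so that
`P(R(X) > z) = E[X]⁻¹ ∫_z^∞ P(X > y) dy` for `z ≥ 0`. -/
def residualLife (ν : Measure ℝ) : Measure ℝ :=
  (volume.restrict (Ici (0 : ℝ))).withDensity
    fun y => ν (Ioi y) / ENNReal.ofReal (∫ x, x ∂ν)

/-- The time of event number `k + 1` when the successive inter-event times are
`ξ 0, ξ 1, ξ 2, …`. -/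
def eventTime (ξ : ℕ → ℝ) (k : ℕ) : ℝ := ∑ j ∈ Finset.range (k + 1), ξ j

/-- The counting process with inter-event times `ξ 0, ξ 1, …`: the number of events in `[0, t]`. -/
def renewalCount (ξ : ℕ → ℝ) (t : ℝ) : ℕ := {k : ℕ | eventTime ξ k ≤ t}.ncard

/-! ### The first-come-first-served queue with `n` servers -/

/-- If server `i` becomes free at time `w i` (having dealt with all the earlier jobs), a job that
arrives at time `a` enters service at this time: on arrival, or as soon as a server is free. -/
def serviceStart {n : ℕ} (w : Fin n → ℝ) (a : ℝ) : ℝ := max a (⨅ i, w i)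

/-- The job goes to server `i`, the server of least index that is free when the job enters
service. -/
def IsAssigned {n : ℕ} (w : Fin n → ℝ) (a : ℝ) (i : Fin n) : Prop :=
  w i ≤ serviceStart w a ∧ ∀ j < i, serviceStart w a < w j

open Classical in
/-- `freeTime W T S k i` is the time from which server `i` is free once it has completed those of
the first `k` arriving jobs that are assigned to it. At time `0` server `i` holds one job with
remaining processing time `W i`, and no job waits. The jobs arrive at the times `T 0, T 1, …` with
processing times `S 0, S 1, …`, and enter service in order of arrival. -/
def freeTime {n : ℕ} (W : Fin n → ℝ) (T S : ℕ → ℝ) : ℕ → Fin n → ℝ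
  | 0 => W
  | k + 1 => fun i =>
      if IsAssigned (freeTime W T S k) (T k) i then
        serviceStart (freeTime W T S k) (T k) + S k
      else freeTime W T S k i

/-- The departure time of the job that arrives at time `T k`. -/
def departureTime {n : ℕ} (W : Fin n → ℝ) (T S : ℕ → ℝ) (k : ℕ) : ℝ :=
  serviceStart (freeTime W T S k) (T k) + S k

/-- The number of jobs in system (in service or waiting) at time `t`: the initial jobs that are
still present, and the jobs that have arrived by time `t` and have not departed by time `t`. -/
def numberInSystem {n : ℕ} (W : Fin n → ℝ) (T S : ℕ → ℝ) (t : ℝ) : ℕ :=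
  {i : Fin n | t < W i}.ncard + {k : ℕ | T k ≤ t ∧ t < departureTime W T S k}.ncard

/-! ### The bounding random variable -/

/-- For counting processes `A` and `N i`, and a set `J` of times,
`max (1 + sup_{0 ≤ s ≤ δ} (A(s) - ∑_{i ≤ η} N_i(s)), sup_{s ∈ J} (A(s) - ∑_{i ≤ n} N_i(s)) +
∑_{i > η} N_i(δ)) + ∑_{i > η} I(N_i(δ) = 0)`, an extended real number. The servers `1, …, η` are
the `i : Fin n` with `i.val < η`. -/
def upperBoundVar {n : ℕ} (A : ℝ → ℕ) (N : Fin n → ℝ → ℕ) (δ : ℝ) (η : ℕ) (J : Set ℝ) : EReal :=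
  max
    (1 + ⨆ s ∈ Icc 0 δ, (((A s : ℝ) - ∑ i with i.val < η, (N i s : ℝ) : ℝ) : EReal))
    ((⨆ s ∈ J, (((A s : ℝ) - ∑ i, (N i s : ℝ) : ℝ) : EReal))
      + ((∑ i with η ≤ i.val, (N i δ : ℝ) : ℝ) : EReal))
  + ((∑ i with η ≤ i.val, (if N i δ = 0 then 1 else 0 : ℝ) : ℝ) : EReal)

end

/-!
The proof couples the queue with a *dominating schedule*, bounds that schedule path by path, and then
reverses time. Fix `t`, `δ ∈ [0, t]` and `η`.

*The dominating schedule.* Let server `i` run the renewal process `N_i` without interruption. Jobs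
wait until a server has a renewal epoch: they start only at such epochs, in order of arrival, at most
one job at each epoch, and the processing time of a job is the interval that follows its epoch.
Outside `[t - δ, t]` the epochs of all servers may be used, in this interval only those of the
servers `i < η`. An epoch with its place in its process is a pair `(i, m)`, and `IsSlot` says which one a job
gets.

*Why it dominates.* Given the processing times, first come, first served starts each job no later
than any other schedule that starts the jobs in order of arrival (`serviceStart_le_of_schedule`).
So the queue fed with the processing times of the dominating schedule holds at most as many jobs.
It is the queue of the theorem in law: whether a job starts at the epoch `(i, m)`, and all that
precedes, does not depend on the interval that follows this epoch (`slot_history_congr`), hence the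
processing times are again independent with the right law, also of the arrivals and the initial jobs
(`hasLaw_slotService`).

*The pathwise bound.* At time `t` there are at most `η` jobs on the servers `i < η`, and a server
`i ≥ η` still holds a job only if `N_i` has no event in `[t - δ, t]` (`inService_le`). If jobs wait
at time `t`, consider the arrival time `u` of the first job of the current busy period: all usable
epochs in `[u, t]` have started a job that arrived in `[u, t]`, so the number of waiting jobs is at
most the number of arrivals minus the number of usable epochs in `[u, t]` (`waiting_add_active_le`).

*Reversal.* Seen backwards from `t`, this is the random variable of the theorem, evaluated at the
arrivals. An equilibrium renewal process on `[0, t]` has the same law as its reversal: on the event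
that there are `m + 1` epochs, the first epoch and the `m` intervals between the epochs have the
density `P(X > y) P(X > t - y - ∑ x) / E[X]` with respect to `dy ν(dx₁) ⋯ ν(dxₘ)`, which is symmetric
under `y ↦ t - y - ∑ x` and reversal of `x` (`map_truncatedEvents_eq_map_reversedEvents`).

The bound for the limit follows from the portmanteau theorem, applied to the open set `(x, ∞)`, since
the supremum over `[δ, t]` is at most that over `[δ, ∞)`.
-/

/-! ### Measurability of the number of jobs in system -/

theorem Measurable.lt_prop {Ω : Type*} [MeasurableSpace Ω] {f g : Ω → ℝ} (hf : Measurable f)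
    (hg : Measurable g) : Measurable fun ω => f ω < g ω :=
  measurableSet_setOfPred.1 (measurableSet_lt hf hg)

theorem Measurable.le_prop {Ω : Type*} [MeasurableSpace Ω] {f g : Ω → ℝ} (hf : Measurable f)
    (hg : Measurable g) : Measurable fun ω => f ω ≤ g ω :=
  measurableSet_setOfPred.1 (measurableSet_le hf hg)

theorem measurable_ncard_setOf {Ω α : Type*} [MeasurableSpace Ω] [Countable α] {p : α → Ω → Prop}
    (hp : ∀ k, Measurable (p k)) : Measurable fun ω => {k | p k ω}.ncard :=
  measurable_ncard.comp (measurable_set_iff.2 hp)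

theorem measurable_eventTime {Ω : Type*} [MeasurableSpace Ω] {ξ : ℕ → Ω → ℝ}
    (hξ : ∀ k, Measurable (ξ k)) (k : ℕ) : Measurable fun ω => eventTime (fun j => ξ j ω) k := by
  unfold eventTime
  fun_prop

theorem measurable_renewalCount {Ω : Type*} [MeasurableSpace Ω] {ξ : ℕ → Ω → ℝ}
    (hξ : ∀ k, Measurable (ξ k)) (t : ℝ) :
    Measurable fun ω => renewalCount (fun j => ξ j ω) t :=
  measurable_ncard_setOf fun k => (measurable_eventTime hξ k).le_prop measurable_const

theorem measurable_serviceStart {Ω : Type*} [MeasurableSpace Ω] {n : ℕ} {w : Ω → Fin n → ℝ}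
    {a : Ω → ℝ} (hw : ∀ i, Measurable fun ω => w ω i) (ha : Measurable a) :
    Measurable fun ω => serviceStart (w ω) (a ω) := by
  unfold serviceStart
  exact ha.max (Measurable.iInf hw)

theorem measurable_isAssigned {Ω : Type*} [MeasurableSpace Ω] {n : ℕ} {w : Ω → Fin n → ℝ}
    {a : Ω → ℝ} (hw : ∀ i, Measurable fun ω => w ω i) (ha : Measurable a) (i : Fin n) :
    Measurable fun ω => IsAssigned (w ω) (a ω) i := by
  have h := measurable_serviceStart hw ha
  unfold IsAssigned
  exact ((hw i).le_prop h).and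
    (Measurable.forall fun j => measurable_const.imp (h.lt_prop (hw j)))

theorem measurable_freeTime {Ω : Type*} [MeasurableSpace Ω] {n : ℕ} {W : Ω → Fin n → ℝ}
    {T S : ℕ → Ω → ℝ} (hW : ∀ i, Measurable fun ω => W ω i) (hT : ∀ k, Measurable (T k))
    (hS : ∀ k, Measurable (S k)) (k : ℕ) (i : Fin n) :
    Measurable fun ω => freeTime (W ω) (fun k => T k ω) (fun k => S k ω) k i := by
  induction k generalizing i with
  | zero => exact hW i
  | succ k ih =>
    unfold freeTime
    classical
    refine Measurable.ite (measurable_isAssigned ih (hT k) i).setOf ?_ (ih i)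
    exact (measurable_serviceStart ih (hT k)).add (hS k)

theorem measurable_numberInSystem {Ω : Type*} [MeasurableSpace Ω] {n : ℕ} {W : Ω → Fin n → ℝ}
    {T S : ℕ → Ω → ℝ} (hW : ∀ i, Measurable fun ω => W ω i) (hT : ∀ k, Measurable (T k))
    (hS : ∀ k, Measurable (S k)) (t : ℝ) :
    Measurable fun ω => numberInSystem (W ω) (fun k => T k ω) (fun k => S k ω) t := by
  unfold numberInSystem departureTime
  refine (measurable_ncard_setOf fun i => measurable_const.lt_prop (hW i)).add
    (measurable_ncard_setOf fun k => ((hT k).le_prop measurable_const).and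
      (measurable_const.lt_prop ?_))
  exact (measurable_serviceStart (measurable_freeTime hW hT hS k) (hT k)).add (hS k)

/-! ### First come, first served is the earliest schedule in order of arrival -/

/-- The times from which the servers are free in a schedule that sends job `k` to server `c k`,
where it is completed at time `D k`: the value at `k` accounts for the first `k` jobs. -/
def scheduleFree {n : ℕ} (W : Fin n → ℝ) (c : ℕ → Fin n) (D : ℕ → ℝ) : ℕ → Fin n → ℝ
  | 0 => W
  | k + 1 => Function.update (scheduleFree W c D k) (c k) (D k)

theorem card_lt_update {n : ℕ} (f : Fin n → ℝ) (j : Fin n) (d s : ℝ) (hj : f j ≤ s) :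
    (Finset.univ.filter fun i => s < Function.update f j d i).card =
      (Finset.univ.filter fun i => s < f i).card + if s < d then 1 else 0 := by
  split_ifs with h
  · rw [← Finset.card_insert_of_notMem (a := j) (by simp [hj])]
    congr 1
    ext i
    by_cases hi : i = j
    · subst hi; simp [h]
    · simp [hi]
  · rw [add_zero]
    congr 1
    ext i
    by_cases hi : i = j
    · subst hi; simp [h, not_lt.2 hj]
    · simp [hi]

theorem exists_isAssigned {n : ℕ} (hn : 0 < n) (w : Fin n → ℝ) (a : ℝ) :
    ∃ i, IsAssigned w a i := by
  classical
  have : Nonempty (Fin n) := ⟨⟨0, hn⟩⟩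
  obtain ⟨i, hi⟩ := exists_eq_ciInf_of_finite (f := w)
  have hne : (Finset.univ.filter fun i => w i ≤ serviceStart w a).Nonempty :=
    ⟨i, by simp [serviceStart, hi]⟩
  refine ⟨Finset.min' _ hne, (Finset.mem_filter.1 (Finset.min'_mem _ hne)).2, fun j hj => ?_⟩
  by_contra hcon
  exact absurd (Finset.min'_le _ j (by simpa using hcon)) (not_le.2 hj)

theorem IsAssigned.unique {n : ℕ} {w : Fin n → ℝ} {a : ℝ} {i j : Fin n} (hi : IsAssigned w a i)
    (hj : IsAssigned w a j) : i = j := by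
  rcases lt_trichotomy i j with h | h | h
  · exact absurd (hj.2 i h) (not_lt.2 hi.1)
  · exact h
  · exact absurd (hi.2 j h) (not_lt.2 hj.1)

theorem freeTime_succ_eq_update {n : ℕ} {W : Fin n → ℝ} {T S : ℕ → ℝ} {k : ℕ} {j : Fin n}
    (hj : IsAssigned (freeTime W T S k) (T k) j) :
    freeTime W T S (k + 1) =
      Function.update (freeTime W T S k) j (serviceStart (freeTime W T S k) (T k) + S k) := by
  ext i
  by_cases hi : i = j
  · subst hi
    simp [freeTime, hj]
  · have : ¬ IsAssigned (freeTime W T S k) (T k) i := fun h => hi (h.unique hj)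
    simp [freeTime, this, hi]

/-- Among the schedules that start the jobs in order of arrival, first come, first served starts
each job earliest. The reason is the invariant: at every time `s` after the start of the first `k`
jobs in the other schedule, no fewer servers are occupied beyond `s` by these jobs there. -/
theorem serviceStart_le_of_schedule {n : ℕ} {W : Fin n → ℝ} {T S τ : ℕ → ℝ}
    {c : ℕ → Fin n} (hT : ∀ k, T k ≤ τ k) (hτ : Monotone τ)
    (hfree : ∀ k, scheduleFree W c (fun k => τ k + S k) k (c k) ≤ τ k) (k : ℕ) :
    serviceStart (freeTime W T S k) (T k) ≤ τ k := by
  have hn : 0 < n := Fin.pos (c 0)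
  set w := freeTime W T S with hw
  set v := scheduleFree W c (fun k => τ k + S k) with hv
  have start : ∀ k, ((Finset.univ.filter fun i => τ k < w k i).card ≤
      (Finset.univ.filter fun i => τ k < v k i).card) → serviceStart (w k) (T k) ≤ τ k := by
    intro k hk
    refine max_le (hT k) ?_
    have h1 : (Finset.univ.filter fun i => τ k < v k i).card < n := by
      conv_rhs => rw [← Finset.card_fin n]
      refine Finset.card_lt_card (Finset.filter_ssubset.2 ⟨c k, Finset.mem_univ _, ?_⟩)
      exact not_lt.2 (hfree k)
    by_contra hcon
    have h2 : (Finset.univ.filter fun i => τ k < w k i) = Finset.univ := by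
      refine Finset.filter_true_of_mem fun i _ => (not_le.1 hcon).trans_le ?_
      exact ciInf_le (Set.finite_range _).bddBelow i
    rw [h2, Finset.card_fin] at hk
    omega
  have inv : ∀ k s, (∀ j < k, τ j ≤ s) → (Finset.univ.filter fun i => s < w k i).card ≤
      (Finset.univ.filter fun i => s < v k i).card := by
    intro k
    induction k with
    | zero => intro s _; exact le_rfl
    | succ k ih =>
      intro s hs
      have hks : τ k ≤ s := hs k (by omega)
      have hb := start k (ih (τ k) fun j hj => hτ hj.le)
      obtain ⟨j, hj⟩ := exists_isAssigned hn (w k) (T k)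
      have e1 : w (k + 1) = Function.update (w k) j (serviceStart (w k) (T k) + S k) :=
        freeTime_succ_eq_update hj
      have e2 : v (k + 1) = Function.update (v k) (c k) (τ k + S k) := rfl
      rw [e1, e2, card_lt_update _ _ _ _ (hj.1.trans (hb.trans hks)),
        card_lt_update _ _ _ _ ((hfree k).trans hks)]
      refine add_le_add (ih s fun j hj => hs j (by omega)) ?_
      split_ifs with h1 h2 <;> first | omega | skip
      exact absurd (h1.trans_le (by linarith)) h2
  exact start k (inv k _ fun j hj => hτ hj.le)

/-! ### Renewal paths -/

/-- A sequence of inter-event times that are positive and whose event times tend to infinity. -/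
structure IsRenewalPath (ξ : ℕ → ℝ) : Prop where
  pos : ∀ k, 0 < ξ k
  tendsto : Tendsto (eventTime ξ) atTop atTop

theorem eventTime_zero (ξ : ℕ → ℝ) : eventTime ξ 0 = ξ 0 := by simp [eventTime]

theorem eventTime_succ (ξ : ℕ → ℝ) (k : ℕ) : eventTime ξ (k + 1) = eventTime ξ k + ξ (k + 1) := by
  simp [eventTime, Finset.sum_range_succ _ (k + 1)]

theorem strictMono_eventTime {ξ : ℕ → ℝ} (h : ∀ k, 0 < ξ k) : StrictMono (eventTime ξ) :=
  strictMono_nat_of_lt_succ fun k => by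
    rw [eventTime_succ]; linarith [h (k + 1)]

theorem eventTime_pos {ξ : ℕ → ℝ} (h : ∀ k, 0 < ξ k) (k : ℕ) : 0 < eventTime ξ k :=
  Finset.sum_pos (fun j _ => h j) (by simp)

theorem IsRenewalPath.finite {ξ : ℕ → ℝ} (h : IsRenewalPath ξ) (t : ℝ) :
    {k | eventTime ξ k ≤ t}.Finite := by
  obtain ⟨K, hK⟩ := eventually_atTop.1 (h.tendsto.eventually_gt_atTop t)
  refine (Set.finite_Iio K).subset fun k hk => ?_
  by_contra hcon
  exact absurd (hK k (not_lt.1 hcon)) (not_lt.2 hk)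

theorem IsRenewalPath.eventTime_le_iff {ξ : ℕ → ℝ} (h : IsRenewalPath ξ) (t : ℝ) (k : ℕ) :
    eventTime ξ k ≤ t ↔ k < renewalCount ξ t := by
  have hmono := strictMono_eventTime h.pos
  constructor
  · intro hk
    have : Set.Iic k ⊆ {k | eventTime ξ k ≤ t} := fun j hj => (hmono.monotone hj).trans hk
    have := Set.ncard_le_ncard this (h.finite t)
    simp only [Set.ncard_Iic_nat] at this
    exact this
  · intro hk
    by_contra hcon
    have : {k | eventTime ξ k ≤ t} ⊆ Set.Iio k := by
      intro j hj
      by_contra hj'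
      exact hcon ((hmono.monotone (not_lt.1 hj')).trans hj)
    have := Set.ncard_le_ncard this (Set.finite_Iio k)
    simp only [Set.ncard_Iio_nat] at this
    exact absurd hk (not_lt.2 this)

/-! ### Slots: the dominating schedule in which jobs only start at renewal epochs -/

/-- The time of the event `p = (i, m)`, event number `m + 1` of the process with intervals `V i`. -/
def epoch {n : ℕ} (V : Fin n → ℕ → ℝ) (p : Fin n × ℕ) : ℝ := eventTime (V p.1) p.2

/-- The events of the `n` processes are ordered by time, simultaneous events by index. -/
def slotKey {n : ℕ} (V : Fin n → ℕ → ℝ) (p : Fin n × ℕ) : ℝ ×ₗ Fin n := toLex (epoch V p, p.1)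

/-- `IsSlot act T V k p` says that in the dominating schedule job `k` (arriving at time `T k`) starts
at the event `p = (i, m)`, on server `i` at the time `epoch V p`; it is processed until the next
event of the same process. This is the first event after the start of the preceding job that does
not precede the arrival and that is active: an event of process `i` at time `s` may be used only if
`act i s`. -/
def IsSlot {n : ℕ} (act : Fin n → ℝ → Prop) (T : ℕ → ℝ) (V : Fin n → ℕ → ℝ) :
    ℕ → Fin n × ℕ → Prop
  | 0, p => (act p.1 (epoch V p) ∧ T 0 ≤ epoch V p) ∧
      ∀ q, act q.1 (epoch V q) ∧ T 0 ≤ epoch V q → slotKey V p ≤ slotKey V q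
  | k + 1, p => ∃ p₀, IsSlot act T V k p₀ ∧
      (slotKey V p₀ < slotKey V p ∧ act p.1 (epoch V p) ∧ T (k + 1) ≤ epoch V p) ∧
      ∀ q, slotKey V p₀ < slotKey V q ∧ act q.1 (epoch V q) ∧ T (k + 1) ≤ epoch V q →
        slotKey V p ≤ slotKey V q

section Slots

variable {n : ℕ} {act : Fin n → ℝ → Prop} {T : ℕ → ℝ} {V : Fin n → ℕ → ℝ}

theorem slotKey_le_iff {p q : Fin n × ℕ} : slotKey V p ≤ slotKey V q ↔
    epoch V p < epoch V q ∨ epoch V p = epoch V q ∧ p.1 ≤ q.1 := Prod.Lex.toLex_le_toLex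

theorem slotKey_lt_iff {p q : Fin n × ℕ} : slotKey V p < slotKey V q ↔
    epoch V p < epoch V q ∨ epoch V p = epoch V q ∧ p.1 < q.1 := Prod.Lex.toLex_lt_toLex

theorem epoch_le_of_slotKey_le {p q : Fin n × ℕ} (h : slotKey V p ≤ slotKey V q) :
    epoch V p ≤ epoch V q := by
  rcases slotKey_le_iff.1 h with h | h
  · exact h.le
  · exact h.1.le

theorem slotKey_injective (hV : ∀ i k, 0 < V i k) : Function.Injective (slotKey V) := by
  rintro ⟨i, m⟩ ⟨j, l⟩ h
  simp only [slotKey, EmbeddingLike.apply_eq_iff_eq, Prod.mk.injEq, epoch] at h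
  obtain ⟨h1, rfl⟩ := h
  rw [(strictMono_eventTime (hV i)).injective h1]

theorem slotKey_mk_lt_iff (hV : ∀ i k, 0 < V i k) {i : Fin n} {m l : ℕ} :
    slotKey V (i, m) < slotKey V (i, l) ↔ m < l := by
  rw [slotKey_lt_iff]
  simp [epoch, (strictMono_eventTime (hV i)).lt_iff_lt]

theorem IsSlot.active {k : ℕ} {p : Fin n × ℕ} (h : IsSlot act T V k p) : act p.1 (epoch V p) := by
  cases k with
  | zero => exact h.1.1
  | succ k => obtain ⟨_, _, h, _⟩ := h; exact h.2.1

theorem IsSlot.le_epoch {k : ℕ} {p : Fin n × ℕ} (h : IsSlot act T V k p) : T k ≤ epoch V p := by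
  cases k with
  | zero => exact h.1.2
  | succ k => obtain ⟨_, _, h, _⟩ := h; exact h.2.2

theorem IsSlot.unique (hV : ∀ i k, 0 < V i k) {k : ℕ} {p q : Fin n × ℕ}
    (hp : IsSlot act T V k p) (hq : IsSlot act T V k q) : p = q := by
  induction k generalizing p q with
  | zero => exact slotKey_injective hV (le_antisymm (hp.2 _ hq.1) (hq.2 _ hp.1))
  | succ k ih =>
    obtain ⟨p₀, hp₀, hp1, hp2⟩ := hp
    obtain ⟨q₀, hq₀, hq1, hq2⟩ := hq
    obtain rfl := ih hp₀ hq₀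
    exact slotKey_injective hV (le_antisymm (hp2 _ hq1) (hq2 _ hp1))

theorem finite_epoch_le (hV : ∀ i, IsRenewalPath (V i)) (c : ℝ) :
    {p : Fin n × ℕ | epoch V p ≤ c}.Finite := by
  refine (Set.finite_iUnion fun i => ((hV i).finite c).image (Prod.mk i)).subset ?_
  rintro ⟨i, m⟩ h
  exact mem_iUnion.2 ⟨i, m, h, rfl⟩

theorem exists_least_slotKey (hV : ∀ i, IsRenewalPath (V i)) {C : Fin n × ℕ → Prop}
    (hC : ∃ p, C p) : ∃ p, C p ∧ ∀ q, C q → slotKey V p ≤ slotKey V q := by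
  obtain ⟨q₀, hq₀⟩ := hC
  obtain ⟨p, ⟨hp1, hp2⟩, hp3⟩ := Set.exists_min_image {p | C p ∧ epoch V p ≤ epoch V q₀} (slotKey V)
    ((finite_epoch_le hV _).subset fun p hp => hp.2) ⟨q₀, hq₀, le_rfl⟩
  refine ⟨p, hp1, fun q hq => ?_⟩
  rcases le_or_gt (epoch V q) (epoch V q₀) with h | h
  · exact hp3 q ⟨hq, h⟩
  · exact slotKey_le_iff.2 (Or.inl (hp2.trans_lt h))

theorem exists_isSlot (hn : 0 < n) (hV : ∀ i, IsRenewalPath (V i)) {t : ℝ}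
    (hact : ∀ i s, t < s → act i s) (k : ℕ) : ∃ p, IsSlot act T V k p := by
  have far : ∀ c, ∃ p, c < epoch V p := fun c => by
    obtain ⟨m, hm⟩ := ((hV ⟨0, hn⟩).tendsto.eventually_gt_atTop c).exists
    exact ⟨(⟨0, hn⟩, m), hm⟩
  induction k with
  | zero =>
    refine exists_least_slotKey hV ?_
    obtain ⟨p, hp⟩ := far (max t (T 0))
    exact ⟨p, hact _ _ ((le_max_left _ _).trans_lt hp), ((le_max_right _ _).trans_lt hp).le⟩
  | succ k ih =>
    obtain ⟨p₀, hp₀⟩ := ih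
    obtain ⟨p, hp⟩ := far (max (max t (T (k + 1))) (epoch V p₀))
    simp only [max_lt_iff] at hp
    obtain ⟨q, hq⟩ := exists_least_slotKey hV (C := fun p => slotKey V p₀ < slotKey V p ∧
      act p.1 (epoch V p) ∧ T (k + 1) ≤ epoch V p)
      ⟨p, slotKey_lt_iff.2 (Or.inl hp.2), hact _ _ hp.1.1, hp.1.2.le⟩
    exact ⟨q, p₀, hp₀, hq⟩

variable {I : ℕ → Fin n × ℕ}

theorem slotKey_slot_strictMono (hV : ∀ i k, 0 < V i k) (hI : ∀ k, IsSlot act T V k (I k)) :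
    StrictMono fun k => slotKey V (I k) := by
  refine strictMono_nat_of_lt_succ fun k => ?_
  obtain ⟨p₀, hp₀, h, -⟩ := hI (k + 1)
  rw [(hI k).unique hV hp₀]
  exact h.1

theorem epoch_slot_mono (hV : ∀ i k, 0 < V i k) (hI : ∀ k, IsSlot act T V k (I k)) :
    Monotone fun k => epoch V (I k) :=
  fun _ _ h => epoch_le_of_slotKey_le ((slotKey_slot_strictMono hV hI).monotone h)

/-- If an earlier job starts on the same server, then it is completed by the start of the later
one. -/
theorem eventTime_succ_le_epoch_slot (hV : ∀ i k, 0 < V i k)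
    (hI : ∀ k, IsSlot act T V k (I k)) {j k : ℕ} (hjk : j < k) (hs : (I j).1 = (I k).1) :
    eventTime (V (I j).1) ((I j).2 + 1) ≤ epoch V (I k) := by
  have h := slotKey_slot_strictMono hV hI hjk
  rcases hj : I j with ⟨i, m⟩
  rcases hk : I k with ⟨i', l⟩
  simp only [hj, hk] at hs h ⊢
  subst hs
  rw [slotKey_mk_lt_iff hV] at h
  exact (strictMono_eventTime (hV i)).monotone h

theorem scheduleFree_slot_le (hV : ∀ i k, 0 < V i k) (hI : ∀ k, IsSlot act T V k (I k)) (k : ℕ) :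
    scheduleFree (fun i => V i 0) (fun k => (I k).1)
      (fun k => epoch V (I k) + V (I k).1 ((I k).2 + 1)) k (I k).1 ≤ epoch V (I k) := by
  set v := scheduleFree (fun i => V i 0) (fun k => (I k).1)
      (fun k => epoch V (I k) + V (I k).1 ((I k).2 + 1)) with hv
  have key : ∀ k i, (∃ j < k, (I j).1 = i ∧ v k i = eventTime (V (I j).1) ((I j).2 + 1)) ∨
      v k i = V i 0 := by
    intro k
    induction k with
    | zero => intro i; right; rfl
    | succ k ih =>
      intro i
      by_cases hi : i = (I k).1
      · left
        refine ⟨k, by omega, hi.symm, ?_⟩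
        subst hi
        simp [hv, scheduleFree, eventTime_succ, epoch]
      · have : v (k + 1) i = v k i := by simp [hv, scheduleFree, hi]
        rw [this]
        rcases ih i with ⟨j, hj, h⟩ | h
        · exact Or.inl ⟨j, by omega, h⟩
        · exact Or.inr h
  rcases key k (I k).1 with ⟨j, hj, h1, h2⟩ | h
  · rw [h2]
    exact eventTime_succ_le_epoch_slot hV hI hj h1
  · rw [h, ← eventTime_zero (V (I k).1)]
    exact (strictMono_eventTime (hV _)).monotone (Nat.zero_le _)

theorem departureTime_le_slot (hV : ∀ i k, 0 < V i k) (hI : ∀ k, IsSlot act T V k (I k)) (k : ℕ) :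
    departureTime (fun i => V i 0) T (fun k => V (I k).1 ((I k).2 + 1)) k ≤
      epoch V (I k) + V (I k).1 ((I k).2 + 1) := by
  unfold departureTime
  gcongr
  exact serviceStart_le_of_schedule (c := fun k => (I k).1) (fun k => (hI k).le_epoch)
    (epoch_slot_mono hV hI) (scheduleFree_slot_le hV hI) k

/-- Let `k₀` be the first job of the busy period of the dominating schedule in which job `k` starts:
from the arrival of `k₀` until the start of `k`, all active events start jobs. -/
theorem exists_busy_period (hV : ∀ i k, 0 < V i k) (hI : ∀ k, IsSlot act T V k (I k)) (k : ℕ) :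
    ∃ k₀ ≤ k, (∀ j < k₀, epoch V (I j) < T k₀) ∧
      ∀ q, act q.1 (epoch V q) → T k₀ ≤ epoch V q → slotKey V q < slotKey V (I k) →
        ∃ j, k₀ ≤ j ∧ j < k ∧ I j = q := by
  induction k with
  | zero =>
    refine ⟨0, le_rfl, by simp, fun q h1 h2 h3 => ?_⟩
    exact absurd ((hI 0).2 q ⟨h1, h2⟩) (not_le.2 h3)
  | succ k ih =>
    obtain ⟨p₀, hp₀, -, hmin⟩ := hI (k + 1)
    obtain rfl := (hI k).unique hV hp₀
    rcases lt_or_ge (epoch V (I k)) (T (k + 1)) with h | h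
    · refine ⟨k + 1, le_rfl, fun j hj => (epoch_slot_mono hV hI (by omega)).trans_lt h,
        fun q h1 h2 h3 => ?_⟩
      exact absurd (hmin q ⟨slotKey_lt_iff.2 (Or.inl (h.trans_le h2)), h1, h2⟩) (not_le.2 h3)
    · obtain ⟨k₀, hk₀, h1, h2⟩ := ih
      refine ⟨k₀, by omega, h1, fun q hq1 hq2 hq3 => ?_⟩
      rcases lt_trichotomy (slotKey V q) (slotKey V (I k)) with h4 | h4 | h4
      · obtain ⟨j, hj1, hj2, rfl⟩ := h2 q hq1 hq2 h4
        exact ⟨j, hj1, by omega, rfl⟩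
      · exact ⟨k, hk₀, by omega, (slotKey_injective hV h4).symm⟩
      · exact absurd (hmin q ⟨h4, hq1, h.trans (epoch_le_of_slotKey_le h4.le)⟩) (not_le.2 hq3)

end Slots

/-! ### The pathwise bound -/

/-- The event times in `[0, t]`; the other terms of the sequence are replaced by `t + 1`. -/
noncomputable def truncatedEvents (t : ℝ) (ξ : ℕ → ℝ) (j : ℕ) : ℝ :=
  if eventTime ξ j ≤ t then eventTime ξ j else t + 1

/-- The event times in `[0, t]` as seen backwards from time `t`, in increasing order; the other
terms of the sequence are `t + 1`. -/
noncomputable def reversedEvents (t : ℝ) (ξ : ℕ → ℝ) (j : ℕ) : ℝ :=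
  if j < renewalCount ξ t then t - eventTime ξ (renewalCount ξ t - 1 - j) else t + 1

/-- The number of servers `i ≥ η` whose sequence `b i` has no term up to `δ`. -/
noncomputable def quietCount {n : ℕ} (δ : ℝ) (η : ℕ) (b : Fin n → ℕ → ℝ) : ℝ :=
  ∑ i with η ≤ i.val, if {m | b i m ≤ δ}.ncard = 0 then 1 else 0

/-- The bound on the number of jobs in system exceeds `y + η`, as an event that involves only
countably many times, those of the sequence `a` of arrivals. The first alternative is the case in
which no job waits. -/
def BoundExceeds {n : ℕ} (t δ : ℝ) (η : ℕ) (y : ℝ) (a : ℕ → ℝ) (b : Fin n → ℕ → ℝ) : Prop :=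
  y < quietCount δ η b ∨ ∃ j, a j ≤ t ∧ y < ((j : ℝ) + 1) -
    (if a j ≤ δ then ∑ i with i.val < η, ({m | b i m ≤ a j}.ncard : ℝ)
      else ∑ i, ({m | b i m ≤ a j}.ncard : ℝ) - ∑ i with η ≤ i.val, ({m | b i m ≤ δ}.ncard : ℝ)) +
    quietCount δ η b

theorem ncard_reversedEvents_le {ξ : ℕ → ℝ} (hξ : IsRenewalPath ξ) {s t : ℝ} (hs : s ≤ t) :
    {m | reversedEvents t ξ m ≤ s}.ncard = {m | t - s ≤ eventTime ξ m ∧ eventTime ξ m ≤ t}.ncard := by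
  set K := renewalCount ξ t with hK
  have h1 : {m | reversedEvents t ξ m ≤ s} = {m | m < K ∧ t - s ≤ eventTime ξ (K - 1 - m)} := by
    ext m
    simp only [mem_ofPred_eq, reversedEvents, ← hK]
    split_ifs with h
    · simp only [h, true_and]
      constructor <;> intro _ <;> linarith
    · simp only [h, false_and, iff_false, not_le]
      linarith
  have h2 : {m | t - s ≤ eventTime ξ m ∧ eventTime ξ m ≤ t} =
      (fun m => K - 1 - m) '' {m | m < K ∧ t - s ≤ eventTime ξ (K - 1 - m)} := by
    ext m
    simp only [mem_ofPred_eq, mem_image, hξ.eventTime_le_iff, ← hK]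
    constructor
    · rintro ⟨h1, h2⟩
      refine ⟨K - 1 - m, ⟨by omega, ?_⟩, by omega⟩
      rwa [show K - 1 - (K - 1 - m) = m by omega]
    · rintro ⟨l, ⟨h1, h2⟩, rfl⟩
      exact ⟨h2, by omega⟩
  rw [h1, h2, Set.InjOn.ncard_image]
  intro m hm l hl h
  simp only [mem_ofPred_eq] at hm hl h
  omega

section Bound

variable {n : ℕ} {act : Fin n → ℝ → Prop} {T : ℕ → ℝ} {V : Fin n → ℕ → ℝ} {I : ℕ → Fin n × ℕ}

/-- If jobs wait at time `t` in the dominating schedule, then from the arrival of the first job of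
the current busy period each active event has started a job. -/
theorem waiting_add_active_le {K : ℕ} {t : ℝ} (hV : ∀ i k, 0 < V i k)
    (hI : ∀ k, IsSlot act T V k (I k)) (hK : ∀ k, T k ≤ t ↔ k < K)
    (hne : {k | T k ≤ t ∧ t < epoch V (I k)}.Nonempty) :
    ∃ k₀ < K, {k | T k ≤ t ∧ t < epoch V (I k)}.ncard +
      ∑ i, {m | act i (epoch V (i, m)) ∧ T k₀ ≤ epoch V (i, m) ∧ epoch V (i, m) ≤ t}.ncard ≤
        K - k₀ := by
  obtain ⟨k₁, hk₁, hk₁'⟩ := hne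
  rw [hK] at hk₁
  have hlast : t < epoch V (I (K - 1)) := hk₁'.trans_le (epoch_slot_mono hV hI (by omega))
  obtain ⟨k₀, hk₀, hearly, hbusy⟩ := exists_busy_period hV hI (K - 1)
  refine ⟨k₀, by omega, ?_⟩
  set J := (Finset.Ico k₀ K).filter fun j => epoch V (I j) ≤ t with hJ
  have hTk₀ : T k₀ ≤ t := (hK k₀).2 (by omega)
  have hwait : {k | T k ≤ t ∧ t < epoch V (I k)} ⊆
      ((Finset.Ico k₀ K).filter fun j => ¬ epoch V (I j) ≤ t : Finset ℕ) := by
    rintro k ⟨h1, h2⟩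
    rw [hK] at h1
    simp only [Finset.coe_filter, Finset.mem_Ico, mem_ofPred_eq, not_le]
    refine ⟨⟨?_, h1⟩, h2⟩
    by_contra hcon
    linarith [hearly k (by omega)]
  have hact : ∑ i, {m | act i (epoch V (i, m)) ∧ T k₀ ≤ epoch V (i, m) ∧
      epoch V (i, m) ≤ t}.ncard ≤ J.card := by
    rw [Finset.card_eq_sum_card_fiberwise (f := fun j => (I j).1) (t := Finset.univ) (by simp)]
    refine Finset.sum_le_sum fun i _ => ?_
    classical
    refine le_trans ?_ (Finset.card_image_le (f := fun j => (I j).2))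
    rw [← Set.ncard_coe_finset]
    refine Set.ncard_le_ncard ?_ (Finset.finite_toSet _)
    rintro m ⟨h1, h2, h3⟩
    obtain ⟨j, hj1, hj2, hj3⟩ := hbusy (i, m) h1 h2
      (slotKey_lt_iff.2 (Or.inl (h3.trans_lt hlast)))
    simp only [Finset.coe_image, Finset.coe_filter, mem_image, mem_ofPred_eq, hJ,
      Finset.mem_filter, Finset.mem_Ico]
    exact ⟨j, ⟨⟨⟨hj1, by omega⟩, hj3 ▸ h3⟩, by rw [hj3]⟩, by rw [hj3]⟩
  have hcard : J.card + ((Finset.Ico k₀ K).filter fun j => ¬ epoch V (I j) ≤ t).card = K - k₀ := by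
    rw [hJ, Finset.card_filter_add_card_filter_not, Nat.card_Ico]
  have h1 := Set.ncard_le_ncard hwait (Finset.finite_toSet _)
  rw [Set.ncard_coe_finset] at h1
  omega

/-- The jobs in service at time `t` in the dominating schedule are on different servers, and a server
`i ≥ η` among them has had no event in `[r, t]`. -/
theorem inService_le {t r : ℝ} {η : ℕ} (hV : ∀ i k, 0 < V i k)
    (hI : ∀ k, IsSlot (fun i s => s < r ∨ i.val < η ∨ t < s) T V k (I k)) :
    {i | t < V i 0}.ncard +
      {k | epoch V (I k) ≤ t ∧ t < epoch V (I k) + V (I k).1 ((I k).2 + 1)}.ncard ≤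
        η + {i : Fin n | η ≤ i.val ∧ ∀ m, ¬ (r ≤ eventTime (V i) m ∧ eventTime (V i) m ≤ t)}.ncard := by
  have hmono : ∀ i, StrictMono (eventTime (V i)) := fun i => strictMono_eventTime (hV i)
  set B := {k | epoch V (I k) ≤ t ∧ t < epoch V (I k) + V (I k).1 ((I k).2 + 1)} with hB
  have hnext : ∀ k, epoch V (I k) + V (I k).1 ((I k).2 + 1) =
      eventTime (V (I k).1) ((I k).2 + 1) := fun k => (eventTime_succ _ _).symm
  have hinj : Set.InjOn (fun k => (I k).1) B := by
    have : ∀ j k, j ∈ B → k ∈ B → (I j).1 = (I k).1 → ¬ j < k := by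
      intro j k hj hk h hlt
      have h1 := eventTime_succ_le_epoch_slot hV hI hlt h
      have h2 := hj.2
      rw [hnext] at h2
      linarith [hk.1]
    intro j hj k hk h
    have h1 := this j k hj hk h
    have h2 := this k j hk hj h.symm
    omega
  have hdisj : Disjoint {i | t < V i 0} ((fun k => (I k).1) '' B) := by
    rw [Set.disjoint_left]
    rintro i hi ⟨k, hk, rfl⟩
    have h1 := (hmono (I k).1).monotone (Nat.zero_le (I k).2)
    rw [eventTime_zero] at h1
    have h2 := hk.1
    simp only [mem_ofPred_eq] at hi
    unfold epoch at h2
    linarith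
  have hsub : {i | t < V i 0} ∪ (fun k => (I k).1) '' B ⊆ {i : Fin n | i.val < η} ∪
      {i : Fin n | η ≤ i.val ∧ ∀ m, ¬ (r ≤ eventTime (V i) m ∧ eventTime (V i) m ≤ t)} := by
    rintro i hi
    rcases lt_or_ge i.val η with h | h
    · exact Or.inl h
    · refine Or.inr ⟨h, fun m hm => ?_⟩
      rcases hi with hi | ⟨k, hk, rfl⟩
      · have h1 := (hmono i).monotone (Nat.zero_le m)
        rw [eventTime_zero] at h1
        simp only [mem_ofPred_eq] at hi
        linarith
      · have h1 := hk.2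
        rw [hnext] at h1
        have h2 := (hmono (I k).1).lt_iff_lt.1 (hm.2.trans_lt h1)
        have h3 := (hmono (I k).1).monotone (Nat.lt_succ_iff.1 h2)
        have h4 := hk.1
        rcases (hI k).active with h5 | h5 | h5
        · unfold epoch at h5
          linarith [hm.1]
        · exact absurd h5 (not_lt.2 h)
        · linarith
  have hη : {i : Fin n | i.val < η}.ncard ≤ η := by
    have : {i : Fin n | i.val < η}.ncard = (Fin.val '' {i : Fin n | i.val < η}).ncard :=
      (Set.ncard_image_of_injective _ Fin.val_injective).symm
    rw [this]
    exact (Set.ncard_le_ncard (by rintro _ ⟨i, hi, rfl⟩; exact hi) (Set.finite_Iio η)).trans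
      (Set.ncard_Iio_nat η).le
  have hfinB : ((fun k => (I k).1) '' B).Finite := Set.toFinite _
  rw [← hinj.ncard_image, ← Set.ncard_union_eq hdisj (Set.toFinite _) hfinB]
  refine (Set.ncard_le_ncard hsub (Set.toFinite _)).trans ((Set.ncard_union_le _ _).trans ?_)
  omega

theorem numberInSystem_le {t r : ℝ} {η : ℕ} (hV : ∀ i k, 0 < V i k)
    (hI : ∀ k, IsSlot (fun i s => s < r ∨ i.val < η ∨ t < s) T V k (I k))
    (hT : {k | T k ≤ t}.Finite) :
    numberInSystem (fun i => V i 0) T (fun k => V (I k).1 ((I k).2 + 1)) t ≤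
      {k | T k ≤ t ∧ t < epoch V (I k)}.ncard + (η +
        {i : Fin n | η ≤ i.val ∧ ∀ m, ¬ (r ≤ eventTime (V i) m ∧ eventTime (V i) m ≤ t)}.ncard) := by
  have hsub : {k | T k ≤ t ∧ t < departureTime (fun i => V i 0) T
        (fun k => V (I k).1 ((I k).2 + 1)) k} ⊆ {k | T k ≤ t ∧ t < epoch V (I k)} ∪
      {k | epoch V (I k) ≤ t ∧ t < epoch V (I k) + V (I k).1 ((I k).2 + 1)} := by
    rintro k ⟨h1, h2⟩
    rcases lt_or_ge t (epoch V (I k)) with h | h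
    · exact Or.inl ⟨h1, h⟩
    · exact Or.inr ⟨h, h2.trans_le (departureTime_le_slot hV hI k)⟩
  have hfin : ({k | T k ≤ t ∧ t < epoch V (I k)} ∪
      {k | epoch V (I k) ≤ t ∧ t < epoch V (I k) + V (I k).1 ((I k).2 + 1)}).Finite :=
    hT.subset (union_subset (fun k hk => hk.1) fun k hk => (hI k).le_epoch.trans hk.1)
  have h1 := (Set.ncard_le_ncard hsub hfin).trans (Set.ncard_union_le _ _)
  have h2 := inService_le hV hI
  unfold numberInSystem
  beta_reduce
  omega

theorem quietCount_reversedEvents {δ t : ℝ} {η : ℕ} (hV : ∀ i, IsRenewalPath (V i)) (hδ : δ ≤ t) :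
    quietCount δ η (fun i => reversedEvents t (V i)) = {i : Fin n | η ≤ i.val ∧
      ∀ m, ¬ (t - δ ≤ eventTime (V i) m ∧ eventTime (V i) m ≤ t)}.ncard := by
  classical
  unfold quietCount
  rw [← Finset.sum_filter, Finset.filter_filter, Finset.sum_const, nsmul_eq_mul, mul_one,
    ← Set.ncard_coe_finset]
  congr 2
  ext i
  simp only [Finset.coe_filter, Finset.mem_univ, true_and, mem_ofPred_eq]
  refine and_congr_right fun _ => ?_
  rw [ncard_reversedEvents_le (hV i) hδ,
    Set.ncard_eq_zero (((hV i).finite t).subset fun m hm => hm.2), Set.eq_empty_iff_forall_notMem]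
  rfl

/-- The pathwise domination. In the dominating schedule all servers are active before time `t - δ`,
only the servers `i < η` from then until `t`, and all again after `t`, so that every job has a
slot. -/
theorem boundExceeds_of_lt_numberInSystem {U : ℕ → ℝ} {t δ x : ℝ} {η : ℕ} (hδ : δ ≤ t)
    (hU : IsRenewalPath U) (hV : ∀ i, IsRenewalPath (V i))
    (hI : ∀ k, IsSlot (fun i s => s < t - δ ∨ i.val < η ∨ t < s) (eventTime U) V k (I k))
    (hx : x < numberInSystem (fun i => V i 0) (eventTime U)
      (fun k => V (I k).1 ((I k).2 + 1)) t) :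
    BoundExceeds t δ η (x - η) (reversedEvents t U) (fun i => reversedEvents t (V i)) := by
  have hpos : ∀ i k, 0 < V i k := fun i => (hV i).pos
  have hQ := numberInSystem_le hpos hI (hU.finite t)
  have hQ' : (numberInSystem (fun i => V i 0) (eventTime U)
      (fun k => V (I k).1 ((I k).2 + 1)) t : ℝ) ≤
      ({k | eventTime U k ≤ t ∧ t < epoch V (I k)}.ncard : ℝ) + (η +
        quietCount δ η (fun i => reversedEvents t (V i))) := by
    rw [quietCount_reversedEvents hV hδ]
    exact_mod_cast hQ
  rcases Set.eq_empty_or_nonempty {k | eventTime U k ≤ t ∧ t < epoch V (I k)} with hne | hne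
  · left
    rw [hne, Set.ncard_empty, Nat.cast_zero] at hQ'
    linarith
  · right
    obtain ⟨k₀, hk₀, hle⟩ := waiting_add_active_le (K := renewalCount U t) hpos hI
      (fun k => hU.eventTime_le_iff t k) hne
    have hs : reversedEvents t U (renewalCount U t - 1 - k₀) = t - eventTime U k₀ := by
      rw [reversedEvents, if_pos (by omega)]
      congr 2
      omega
    have hUk := eventTime_pos hU.pos k₀
    refine ⟨renewalCount U t - 1 - k₀, by rw [hs]; linarith, ?_⟩
    rw [hs]
    have hcast : ((renewalCount U t - 1 - k₀ : ℕ) : ℝ) + 1 = ((renewalCount U t - k₀ : ℕ) : ℝ) := by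
      rw [← Nat.cast_add_one]
      congr 1
      omega
    rw [hcast]
    have hcount : ∀ i s, s ≤ t → {m | reversedEvents t (V i) m ≤ s}.ncard =
        {m | t - s ≤ eventTime (V i) m ∧ eventTime (V i) m ≤ t}.ncard :=
      fun i s hs => ncard_reversedEvents_le (hV i) hs
    have hle' : ({k | eventTime U k ≤ t ∧ t < epoch V (I k)}.ncard : ℝ) + ∑ i,
        ({m | (epoch V (i, m) < t - δ ∨ i.val < η ∨ t < epoch V (i, m)) ∧
          eventTime U k₀ ≤ epoch V (i, m) ∧ epoch V (i, m) ≤ t}.ncard : ℝ) ≤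
        ((renewalCount U t - k₀ : ℕ) : ℝ) := by exact_mod_cast hle
    have hactive : (if t - eventTime U k₀ ≤ δ then
          ∑ i with i.val < η, ({m | reversedEvents t (V i) m ≤ t - eventTime U k₀}.ncard : ℝ)
        else ∑ i, ({m | reversedEvents t (V i) m ≤ t - eventTime U k₀}.ncard : ℝ) -
          ∑ i with η ≤ i.val, ({m | reversedEvents t (V i) m ≤ δ}.ncard : ℝ)) ≤ ∑ i,
        ({m | (epoch V (i, m) < t - δ ∨ i.val < η ∨ t < epoch V (i, m)) ∧
          eventTime U k₀ ≤ epoch V (i, m) ∧ epoch V (i, m) ≤ t}.ncard : ℝ) := by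
      have hfin : ∀ i, {m | (epoch V (i, m) < t - δ ∨ i.val < η ∨ t < epoch V (i, m)) ∧
          eventTime U k₀ ≤ epoch V (i, m) ∧ epoch V (i, m) ≤ t}.Finite := fun i =>
        ((hV i).finite t).subset fun m hm => hm.2.2
      split_ifs with hcase
      · rw [Finset.sum_filter]
        refine Finset.sum_le_sum fun i _ => ?_
        split_ifs with hi
        · rw [hcount i _ (by linarith)]
          refine Nat.cast_le.2 (Set.ncard_le_ncard ?_ (hfin i))
          rintro m ⟨h1, h2⟩
          exact ⟨Or.inr (Or.inl hi), by unfold epoch; simpa using h1, h2⟩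
        · positivity
      · rw [Finset.sum_filter, ← Finset.sum_sub_distrib]
        refine Finset.sum_le_sum fun i _ => ?_
        rw [hcount i _ (by linarith)]
        split_ifs with hi
        · rw [hcount i _ hδ, sub_le_iff_le_add, ← Nat.cast_add]
          refine Nat.cast_le.2 (le_trans (Set.ncard_le_ncard ?_ ((hfin i).union
            (((hV i).finite t).subset fun m hm => hm.2))) (Set.ncard_union_le _ _))
          rintro m ⟨h1, h2⟩
          rcases lt_or_ge (eventTime (V i) m) (t - δ) with h | h
          · exact Or.inl ⟨Or.inl h, by unfold epoch; simpa using h1, h2⟩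
          · exact Or.inr ⟨h, h2⟩
        · rw [sub_zero]
          refine Nat.cast_le.2 (Set.ncard_le_ncard ?_ (hfin i))
          rintro m ⟨h1, h2⟩
          exact ⟨Or.inr (Or.inl (not_le.1 hi)), by unfold epoch; simpa using h1, h2⟩
    linarith

end Bound

/-! ### Slots do not anticipate the processing times -/

section Nonanticipation

variable {n : ℕ} {act : Fin n → ℝ → Prop} {T : ℕ → ℝ} {V V' : Fin n → ℕ → ℝ}

theorem IsSlot.slotKey_lt (hV : ∀ i k, 0 < V i k) {j k : ℕ} {p q : Fin n × ℕ} (hjk : j < k)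
    (hq : IsSlot act T V j q) (hp : IsSlot act T V k p) : slotKey V q < slotKey V p := by
  induction k generalizing p with
  | zero => omega
  | succ k ih =>
    obtain ⟨p₀, hp₀, h, -⟩ := hp
    rcases (Nat.lt_succ_iff.1 hjk).eq_or_lt with rfl | h'
    · exact (hq.unique hV hp₀) ▸ h.1
    · exact (ih h' hp₀).trans h.1

/-- Two families of intervals whose events agree, except possibly for those that follow the event
`p` in its process, have the same slots up to `p`. -/
theorem IsSlot.congr (hV : ∀ i k, 0 < V i k) (hV' : ∀ i k, 0 < V' i k) {p : Fin n × ℕ}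
    (h : ∀ q : Fin n × ℕ, q.1 ≠ p.1 ∨ q.2 ≤ p.2 → epoch V q = epoch V' q) {k : ℕ} {q : Fin n × ℕ}
    (hqp : slotKey V q ≤ slotKey V p) (hq : IsSlot act T V k q) : IsSlot act T V' k q := by
  have early : ∀ W : Fin n → ℕ → ℝ, (∀ i k, 0 < W i k) → ∀ q, slotKey W q ≤ slotKey W p →
      q.1 ≠ p.1 ∨ q.2 ≤ p.2 := by
    rintro W hW ⟨i, m⟩ hq
    by_contra! hcon
    obtain ⟨h1, h2⟩ := hcon
    obtain ⟨i', l⟩ := p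
    simp only at h1 h2
    subst h1
    exact absurd hq (not_le.2 ((slotKey_mk_lt_iff hW).2 h2))
  have hkey : ∀ q : Fin n × ℕ, q.1 ≠ p.1 ∨ q.2 ≤ p.2 → slotKey V q = slotKey V' q := by
    intro q hq
    simp only [slotKey, h q hq]
  have hpp := hkey p (Or.inr le_rfl)
  induction k generalizing q with
  | zero =>
    have hq' := early V hV q hqp
    refine ⟨by rw [← h q hq']; exact hq.1, fun q' hC => ?_⟩
    by_contra! hlt
    rw [← hkey q hq'] at hlt
    have hq'' := early V' hV' q' (hlt.le.trans (hqp.trans hpp.le))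
    rw [← h q' hq''] at hC
    rw [← hkey q' hq''] at hlt
    exact absurd (hq.2 q' hC) (not_le.2 hlt)
  | succ k ih =>
    have hq' := early V hV q hqp
    obtain ⟨p₀, hp₀, hC, hmin⟩ := hq
    have hp₀p := hC.1.le.trans hqp
    have hp₀' := early V hV p₀ hp₀p
    refine ⟨p₀, ih hp₀p hp₀, by rw [← h q hq', ← hkey q hq', ← hkey p₀ hp₀']; exact hC,
      fun q' hC' => ?_⟩
    by_contra! hlt
    rw [← hkey q hq'] at hlt
    have hq'' := early V' hV' q' (hlt.le.trans (hqp.trans hpp.le))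
    rw [← h q' hq'', ← hkey q' hq'', ← hkey p₀ hp₀'] at hC'
    rw [← hkey q' hq''] at hlt
    exact absurd (hmin q' hC') (not_le.2 hlt)

/-- If job `K` starts at `p`, then neither this nor the slots and processing times of the earlier jobs
involve the interval that follows `p`, which is the processing time of job `K`. -/
theorem slot_history_congr (hV : ∀ i k, 0 < V i k) (hV' : ∀ i k, 0 < V' i k) {p : Fin n × ℕ}
    (h : ∀ i k, (i, k) ≠ (p.1, p.2 + 1) → V i k = V' i k) {B : ℕ → Set ℝ} {K : ℕ}
    (hp : IsSlot act T V K p)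
    (hB : ∀ k < K, ∃ q, IsSlot act T V k q ∧ V q.1 (q.2 + 1) ∈ B k) :
    IsSlot act T V' K p ∧ ∀ k < K, ∃ q, IsSlot act T V' k q ∧ V' q.1 (q.2 + 1) ∈ B k := by
  have hepoch : ∀ q : Fin n × ℕ, q.1 ≠ p.1 ∨ q.2 ≤ p.2 → epoch V q = epoch V' q := by
    rintro ⟨i, m⟩ hq
    unfold epoch eventTime
    refine Finset.sum_congr rfl fun l hl => h i l ?_
    rw [Finset.mem_range] at hl
    simp only [ne_eq, Prod.mk.injEq, not_and] at hq ⊢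
    rintro rfl rfl
    omega
  refine ⟨hp.congr hV hV' hepoch le_rfl, fun k hk => ?_⟩
  obtain ⟨q, hq, hqB⟩ := hB k hk
  have hlt := hq.slotKey_lt hV hk hp
  refine ⟨q, hq.congr hV hV' hepoch hlt.le, ?_⟩
  rw [← h]
  · exact hqB
  · intro heq
    simp only [Prod.mk.injEq, add_left_inj] at heq
    exact hlt.ne (by rw [Prod.ext heq.1 heq.2])

end Nonanticipation

/-! ### The processing times picked at the slots -/

theorem Measurable.isSlot {Ω : Type*} [MeasurableSpace Ω] {n : ℕ} {act : Fin n → ℝ → Prop}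
    (hact : ∀ i, Measurable (act i)) {T : ℕ → Ω → ℝ} {V : Fin n → ℕ → Ω → ℝ}
    (hT : ∀ k, Measurable (T k)) (hV : ∀ i k, Measurable (V i k)) (k : ℕ) (p : Fin n × ℕ) :
    Measurable fun ω => IsSlot act (fun k => T k ω) (fun i k => V i k ω) k p := by
  have he : ∀ p : Fin n × ℕ, Measurable fun ω => epoch (fun i k => V i k ω) p := fun p =>
    measurable_eventTime (hV p.1) p.2
  have hact' : ∀ p : Fin n × ℕ, Measurable fun ω => act p.1 (epoch (fun i k => V i k ω) p) :=
    fun p => (hact p.1).comp (he p)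
  have heq : ∀ p q : Fin n × ℕ, Measurable fun ω =>
      epoch (fun i k => V i k ω) p = epoch (fun i k => V i k ω) q := fun p q =>
    measurableSet_setOfPred.1 (measurableSet_eq_fun (he p) (he q))
  have hle : ∀ p q : Fin n × ℕ, Measurable fun ω =>
      slotKey (fun i k => V i k ω) p ≤ slotKey (fun i k => V i k ω) q := fun p q => by
    simp only [slotKey_le_iff]
    exact ((he p).lt_prop (he q)).or ((heq p q).and measurable_const)
  have hlt : ∀ p q : Fin n × ℕ, Measurable fun ω =>
      slotKey (fun i k => V i k ω) p < slotKey (fun i k => V i k ω) q := fun p q => by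
    simp only [slotKey_lt_iff]
    exact ((he p).lt_prop (he q)).or ((heq p q).and measurable_const)
  induction k generalizing p with
  | zero =>
    exact ((hact' p).and ((hT 0).le_prop (he p))).and (Measurable.forall fun q =>
      ((hact' q).and ((hT 0).le_prop (he q))).imp (hle p q))
  | succ k ih =>
    exact Measurable.exists fun p₀ => (ih p₀).and (((hlt p₀ p).and ((hact' p).and
      ((hT (k + 1)).le_prop (he p)))).and (Measurable.forall fun q =>
        ((hlt p₀ q).and ((hact' q).and ((hT (k + 1)).le_prop (he q)))).imp (hle p q)))

open Classical in
/-- The processing time of job `k` in the dominating schedule: the interval that follows its slot.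
It is written as a sum, with one nonzero term, to be measurable. -/
noncomputable def slotService {n : ℕ} (act : Fin n → ℝ → Prop) (T : ℕ → ℝ) (V : Fin n → ℕ → ℝ)
    (k : ℕ) : ℝ :=
  (∑' p : Fin n × ℕ, if IsSlot act T V k p then ENNReal.ofReal (V p.1 (p.2 + 1)) else 0).toReal

theorem IsSlot.slotService_eq {n : ℕ} {act : Fin n → ℝ → Prop} {T : ℕ → ℝ} {V : Fin n → ℕ → ℝ}
    (hV : ∀ i k, 0 < V i k) {k : ℕ} {p : Fin n × ℕ} (hp : IsSlot act T V k p) :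
    slotService act T V k = V p.1 (p.2 + 1) := by
  rw [slotService, tsum_eq_single p, if_pos hp, ENNReal.toReal_ofReal (hV _ _).le]
  intro q hq
  rw [if_neg fun h => hq (h.unique hV hp)]

theorem measurable_slotService {Ω : Type*} [MeasurableSpace Ω] {n : ℕ} {act : Fin n → ℝ → Prop}
    (hact : ∀ i, Measurable (act i)) {T : ℕ → Ω → ℝ} {V : Fin n → ℕ → Ω → ℝ}
    (hT : ∀ k, Measurable (T k)) (hV : ∀ i k, Measurable (V i k)) (k : ℕ) :
    Measurable fun ω => slotService act (fun k => T k ω) (fun i k => V i k ω) k := by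
  unfold slotService
  refine ENNReal.measurable_toReal.comp (Measurable.tsum fun p => ?_)
  exact Measurable.ite (Measurable.isSlot hact hT hV k p).setOf
    (hV p.1 (p.2 + 1)).ennreal_ofReal measurable_const

/-- In an independent family, one member is independent of what remains when it is overwritten by a
constant. -/
theorem measure_inter_update_eq_mul {Ω ι : Type*} [MeasurableSpace Ω] [DecidableEq ι]
    {P : Measure Ω} {X : ι → Ω → ℝ} (hX : ∀ i, Measurable (X i)) (hind : iIndepFun X P)
    (p : ι) (c : ℝ) {B : Set ℝ} (hB : MeasurableSet B) {E : Set (ι → ℝ)} (hE : MeasurableSet E) :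
    P ({ω | X p ω ∈ B} ∩ {ω | Function.update (fun i => X i ω) p c ∈ E}) =
      P {ω | X p ω ∈ B} * P {ω | Function.update (fun i => X i ω) p c ∈ E} := by
  have h := indep_iSup_of_disjoint (S := {p}) (T := {p}ᶜ) (fun i => (hX i).comap_le) hind.iIndep
    disjoint_compl_right
  rw [Indep_iff] at h
  refine h _ _ ?_ ?_
  · rw [iSup_singleton]
    exact ⟨B, hB, rfl⟩
  · have : Measurable[⨆ i ∈ ({p}ᶜ : Set ι), MeasurableSpace.comap (X i) inferInstance]
        fun ω => Function.update (fun i => X i ω) p c := by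
      refine @measurable_pi_lambda _ _ _ (_) _ _ fun i => ?_
      by_cases hi : i = p
      · subst hi
        simp
      · simp only [Function.update_of_ne hi]
        refine Measurable.mono (comap_measurable (X i)) ?_ le_rfl
        exact le_iSup₂_of_le i (by simpa using hi) le_rfl
    exact this hE

/-- The processing times picked at the slots are independent with law `ν`, also of the arrivals and
the first intervals: the event `{job K starts at p}` and the history before it do not involve the
interval that follows `p`, so this interval has law `ν` given the history. -/
theorem measure_slotService_history {Ω : Type*} [MeasurableSpace Ω] {P : Measure Ω}
    {n : ℕ} {act : Fin n → ℝ → Prop} (hact : ∀ i, Measurable (act i))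
    {U : ℕ → Ω → ℝ} {V : Fin n → ℕ → Ω → ℝ}
    (hU : ∀ k, Measurable (U k)) (hV : ∀ i k, Measurable (V i k))
    (hind : iIndepFun (Sum.elim U (fun p : Fin n × ℕ => V p.1 p.2)) P)
    {ν : Measure ℝ} (hν : ∀ i k, HasLaw (V i (k + 1)) ν P)
    (hpos : ∀ᵐ ω ∂P, ∀ i k, 0 < V i k ω)
    (hslot : ∀ᵐ ω ∂P, ∀ k, ∃ p, IsSlot act (eventTime fun k => U k ω) (fun i k => V i k ω) k p)
    {C : Set ((ℕ → ℝ) × (Fin n → ℝ))} (hC : MeasurableSet C) {B : ℕ → Set ℝ}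
    (hB : ∀ k, MeasurableSet (B k)) (K : ℕ) :
    P {ω | ((fun k => U k ω), (fun i => V i 0 ω)) ∈ C ∧ ∀ k < K,
      slotService act (eventTime fun k => U k ω) (fun i k => V i k ω) k ∈ B k} =
    P {ω | ((fun k => U k ω), (fun i => V i 0 ω)) ∈ C} * ∏ k ∈ Finset.range K, ν (B k) := by
  induction K with
  | zero => simp
  | succ K ih =>
    -- The interval that follows the slot `p` is the coordinate `next p`.
    let next : Fin n × ℕ → ℕ ⊕ Fin n × ℕ := fun p => Sum.inr (p.1, p.2 + 1)
    let uu : (ℕ ⊕ Fin n × ℕ → ℝ) → ℕ → ℝ := fun z k => z (Sum.inl k)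
    let vv : (ℕ ⊕ Fin n × ℕ → ℝ) → Fin n → ℕ → ℝ := fun z i k => z (Sum.inr (i, k))
    let Z : Ω → ℕ ⊕ Fin n × ℕ → ℝ := fun ω i => Sum.elim U (fun p : Fin n × ℕ => V p.1 p.2) i ω
    have hX : ∀ i, Measurable (Sum.elim U (fun p : Fin n × ℕ => V p.1 p.2) i) := by
      rintro (k | p)
      · exact hU k
      · exact hV p.1 p.2
    have hZ : Measurable Z := measurable_pi_lambda _ hX
    have hslotm : ∀ k p, Measurable fun z => IsSlot act (eventTime (uu z)) (vv z) k p := fun k p =>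
      Measurable.isSlot hact (T := fun k z => eventTime (uu z) k) (V := fun i k z => vv z i k)
        (fun k => measurable_eventTime (fun j => measurable_pi_apply _) k)
        (fun i k => measurable_pi_apply _) k p
    -- The history: `E p` is the event that job `K` starts at `p`, with what precedes it.
    let E : Fin n × ℕ → Set (ℕ ⊕ Fin n × ℕ → ℝ) := fun p => {z | (∀ i k, 0 < vv z i k) ∧
      (uu z, fun i => vv z i 0) ∈ C ∧ IsSlot act (eventTime (uu z)) (vv z) K p ∧
      ∀ k < K, ∃ q, IsSlot act (eventTime (uu z)) (vv z) k q ∧ vv z q.1 (q.2 + 1) ∈ B k}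
    have hE : ∀ p, MeasurableSet (E p) := by
      intro p
      refine measurableSet_setOfPred.2 (Measurable.and ?_ (Measurable.and ?_
        ((hslotm K p).and ?_)))
      · exact Measurable.forall fun i => Measurable.forall fun k =>
          measurable_const.lt_prop (measurable_pi_apply _)
      · refine (measurable_mem.2 hC).comp (Measurable.prodMk ?_ ?_)
        · exact measurable_pi_lambda _ fun k => measurable_pi_apply _
        · exact measurable_pi_lambda _ fun k => measurable_pi_apply _
      · exact Measurable.forall fun k => measurable_const.imp (Measurable.exists fun q =>
          (hslotm k q).and ((measurable_mem.2 (hB k)).comp (measurable_pi_apply _)))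
    have hdisj : Pairwise (Function.onFun Disjoint fun p => Z ⁻¹' E p) := by
      intro p q hpq
      refine Set.disjoint_left.2 fun ω h1 h2 => hpq ?_
      exact h1.2.2.1.unique h1.1 h2.2.2.1
    have hupd : ∀ (z : ℕ ⊕ Fin n × ℕ → ℝ) p, (∀ i k, 0 < vv z i k) →
        (z ∈ E p ↔ Function.update z (next p) 1 ∈ E p) := by
      intro z p hz
      have huu : uu (Function.update z (next p) 1) = uu z := by
        ext k
        simp [uu, next]
      have hv0 : ∀ i, vv (Function.update z (next p) 1) i 0 = vv z i 0 := by
        intro i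
        simp [vv, next]
      have hpos' : ∀ i k, 0 < vv (Function.update z (next p) 1) i k := by
        intro i k
        simp only [vv, Function.update_apply]
        split_ifs
        · exact one_pos
        · exact hz i k
      have hag : ∀ i k, (i, k) ≠ (p.1, p.2 + 1) →
          vv z i k = vv (Function.update z (next p) 1) i k := by
        intro i k h
        simp only [vv]
        rw [Function.update_of_ne]
        simpa [next] using h
      simp only [E, mem_ofPred_eq, huu, hv0]
      constructor
      · rintro ⟨-, h2, h3, h4⟩
        exact ⟨hpos', h2, slot_history_congr hz hpos' hag h3 h4⟩
      · rintro ⟨-, h2, h3, h4⟩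
        exact ⟨hz, h2, slot_history_congr hpos' hz (fun i k h => (hag i k h).symm) h3 h4⟩
    -- On almost all paths the events of the claim are the unions of those in terms of `E p`.
    have hhist : ∀ ω, (∀ i k, 0 < V i k ω) →
        (∀ k, ∃ p, IsSlot act (eventTime fun k => U k ω) (fun i k => V i k ω) k p) → ∀ p, Z ω ∈ E p ↔
        (((fun k => U k ω), (fun i => V i 0 ω)) ∈ C ∧ (∀ k < K,
          slotService act (eventTime fun k => U k ω) (fun i k => V i k ω) k ∈ B k) ∧
          IsSlot act (eventTime fun k => U k ω) (fun i k => V i k ω) K p) := by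
      intro ω h1 h2 p
      have : ∀ k, slotService act (eventTime fun k => U k ω) (fun i k => V i k ω) k ∈ B k ↔
          ∃ q, IsSlot act (eventTime fun k => U k ω) (fun i k => V i k ω) k q ∧
            V q.1 (q.2 + 1) ω ∈ B k := by
        intro k
        obtain ⟨q, hq⟩ := h2 k
        rw [hq.slotService_eq h1]
        refine ⟨fun h => ⟨q, hq, h⟩, ?_⟩
        rintro ⟨q', hq', h⟩
        rwa [hq.unique h1 hq']
      simp only [this]
      constructor
      · rintro ⟨-, h4, h5, h6⟩
        exact ⟨h4, h6, h5⟩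
      · rintro ⟨h4, h6, h5⟩
        exact ⟨h1, h4, h5, h6⟩
    have hunion : P {ω | ((fun k => U k ω), (fun i => V i 0 ω)) ∈ C ∧ ∀ k < K,
        slotService act (eventTime fun k => U k ω) (fun i k => V i k ω) k ∈ B k} =
        ∑' p, P (Z ⁻¹' E p) := by
      rw [← measure_iUnion hdisj fun p => hZ (hE p)]
      refine measure_congr ?_
      filter_upwards [hpos, hslot] with ω h1 h2
      refine propext ?_
      change _ ↔ ω ∈ ⋃ p, Z ⁻¹' E p
      simp only [mem_iUnion, mem_preimage, hhist ω h1 h2]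
      constructor
      · rintro ⟨h3, h4⟩
        obtain ⟨p, hp⟩ := h2 K
        exact ⟨p, h3, h4, hp⟩
      · rintro ⟨p, h3, h4, -⟩
        exact ⟨h3, h4⟩
    have hunion' : P {ω | ((fun k => U k ω), (fun i => V i 0 ω)) ∈ C ∧ ∀ k < K + 1,
        slotService act (eventTime fun k => U k ω) (fun i k => V i k ω) k ∈ B k} =
        ∑' p : Fin n × ℕ, P ({ω | V p.1 (p.2 + 1) ω ∈ B K} ∩ Z ⁻¹' E p) := by
      have hm : ∀ p : Fin n × ℕ, MeasurableSet ({ω | V p.1 (p.2 + 1) ω ∈ B K} ∩ Z ⁻¹' E p) :=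
        fun p => ((hV _ _) (hB K)).inter (hZ (hE p))
      rw [← measure_iUnion (fun p q hpq => (hdisj hpq).mono inter_subset_right inter_subset_right)
        hm]
      refine measure_congr ?_
      filter_upwards [hpos, hslot] with ω h1 h2
      refine propext ?_
      change _ ↔ ω ∈ ⋃ p : Fin n × ℕ, {ω | V p.1 (p.2 + 1) ω ∈ B K} ∩ Z ⁻¹' E p
      simp only [mem_iUnion, mem_inter_iff, mem_preimage, hhist ω h1 h2]
      constructor
      · rintro ⟨h3, h4⟩
        obtain ⟨p, hp⟩ := h2 K
        have h5 := h4 K (by omega)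
        rw [hp.slotService_eq h1] at h5
        exact ⟨p, h5, h3, fun k hk => h4 k (by omega), hp⟩
      · rintro ⟨p, h5, h3, h4, hp⟩
        refine ⟨h3, fun k hk => ?_⟩
        rcases (Nat.lt_succ_iff.1 hk).eq_or_lt with rfl | hk'
        · rw [hp.slotService_eq h1]
          exact h5
        · exact h4 k hk'
    have hfactor : ∀ p : Fin n × ℕ, P ({ω | V p.1 (p.2 + 1) ω ∈ B K} ∩ Z ⁻¹' E p) =
        ν (B K) * P (Z ⁻¹' E p) := by
      intro p
      have hae : (Z ⁻¹' E p : Set Ω) =ᵐ[P] {ω | Function.update (Z ω) (next p) 1 ∈ E p} := by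
        filter_upwards [hpos] with ω h1
        exact propext (hupd (Z ω) p h1)
      have hae' : ({ω | V p.1 (p.2 + 1) ω ∈ B K} ∩ Z ⁻¹' E p : Set Ω) =ᵐ[P]
          ({ω | V p.1 (p.2 + 1) ω ∈ B K} ∩ {ω | Function.update (Z ω) (next p) 1 ∈ E p} : Set Ω) := by
        filter_upwards [hpos] with ω h1
        exact propext (and_congr_right fun _ => hupd (Z ω) p h1)
      have hlaw : P {ω | V p.1 (p.2 + 1) ω ∈ B K} = ν (B K) :=
        (hν p.1 p.2).measure_eq (p := fun y => y ∈ B K) (hB K)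
      rw [measure_congr hae', measure_congr hae, ← hlaw]
      exact measure_inter_update_eq_mul hX hind (next p) 1 (hB K) (hE p)
    rw [hunion', tsum_congr hfactor, ENNReal.tsum_mul_left, ← hunion, ih, Finset.prod_range_succ]
    ring

/-- Arrivals, first intervals and processing times have the same joint law in the dominating schedule
as in the queue. -/
theorem hasLaw_slotService {Ω : Type*} [MeasurableSpace Ω] {P : Measure Ω} [IsProbabilityMeasure P]
    {n : ℕ} {act : Fin n → ℝ → Prop} (hact : ∀ i, Measurable (act i))
    {U : ℕ → Ω → ℝ} {V : Fin n → ℕ → Ω → ℝ}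
    (hU : ∀ k, Measurable (U k)) (hV : ∀ i k, Measurable (V i k))
    (hind : iIndepFun (Sum.elim U (fun p : Fin n × ℕ => V p.1 p.2)) P)
    {lawU : ℕ → Measure ℝ} {ν₀ ν : Measure ℝ} [∀ k, IsProbabilityMeasure (lawU k)]
    [IsProbabilityMeasure ν₀] [IsProbabilityMeasure ν] (hlawU : ∀ k, HasLaw (U k) (lawU k) P)
    (hν₀ : ∀ i, HasLaw (V i 0) ν₀ P) (hν : ∀ i k, HasLaw (V i (k + 1)) ν P)
    (hpos : ∀ᵐ ω ∂P, ∀ i k, 0 < V i k ω)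
    (hslot : ∀ᵐ ω ∂P, ∀ k, ∃ p, IsSlot act (eventTime fun k => U k ω) (fun i k => V i k ω) k p)
    (μ : ℕ ⊕ Fin n ⊕ ℕ → Measure ℝ) [∀ i, IsProbabilityMeasure (μ i)]
    (hμ : μ = Sum.elim lawU (Sum.elim (fun _ => ν₀) (fun _ => ν))) :
    HasLaw (fun ω => Sum.elim (fun k => U k ω) (Sum.elim (fun i => V i 0 ω)
      (slotService act (eventTime fun k => U k ω) (fun i k => V i k ω))))
      (Measure.infinitePi μ) P := by
  have hservice := measurable_slotService hact (T := fun k ω => eventTime (fun k => U k ω) k)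
    (fun k => measurable_eventTime hU k) hV
  have hmeas : Measurable (fun ω => (Sum.elim (fun k => U k ω) (Sum.elim (fun i => V i 0 ω)
      (slotService act (eventTime fun k => U k ω) (fun i k => V i k ω))) : ℕ ⊕ Fin n ⊕ ℕ → ℝ)) := by
    refine measurable_pi_lambda _ ?_
    rintro (k | i | k)
    · exact hU k
    · exact hV i 0
    · exact hservice k
  refine ⟨hmeas.aemeasurable, Measure.eq_infinitePi _ fun s t ht => ?_⟩
  classical
  -- A finite set of indices lies in a box `S`; the sets of the other indices are replaced by `univ`.
  obtain ⟨K, hK⟩ : ∃ K, ∀ i ∈ s, (∀ k, i = Sum.inl k → k < K) ∧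
      (∀ k, i = Sum.inr (Sum.inr k) → k < K) := by
    let f : ℕ ⊕ Fin n ⊕ ℕ → ℕ := Sum.elim id (Sum.elim (fun _ => 0) id)
    refine ⟨s.sup f + 1, fun i hi => ⟨?_, ?_⟩⟩
    · rintro k rfl
      exact Nat.lt_succ_of_le (Finset.le_sup (f := f) hi)
    · rintro k rfl
      exact Nat.lt_succ_of_le (Finset.le_sup (f := f) hi)
  let S : Finset (ℕ ⊕ Fin n ⊕ ℕ) :=
    (Finset.range K).disjSum (Finset.univ.disjSum (Finset.range K))
  have hsS : s ⊆ S := by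
    rintro (k | i | k) hi
    · simp [S, (hK _ hi).1 k rfl]
    · simp [S]
    · simp [S, (hK _ hi).2 k rfl]
  let t' : ℕ ⊕ Fin n ⊕ ℕ → Set ℝ := fun i => if i ∈ s then t i else univ
  have ht' : ∀ i, MeasurableSet (t' i) := by
    intro i
    simp only [t']
    split_ifs
    · exact ht i
    · exact .univ
  have hprod : ∏ i ∈ s, μ i (t i) = ∏ i ∈ S, μ i (t' i) := by
    rw [← Finset.prod_subset hsS (f := fun i => μ i (t' i))]
    · exact Finset.prod_congr rfl fun i hi => by simp [t', hi]
    · intro i _ hi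
      simp [t', hi]
  have hpi : (s : Set (ℕ ⊕ Fin n ⊕ ℕ)).pi t = (S : Set (ℕ ⊕ Fin n ⊕ ℕ)).pi t' := by
    ext z
    simp only [Set.mem_pi, Finset.mem_coe, t']
    refine ⟨fun h i _ => ?_, fun h i hi => by simpa [hi] using h i (hsS hi)⟩
    split_ifs with hi
    · exact h i hi
    · trivial
  rw [hprod, hpi, Measure.map_apply hmeas (MeasurableSet.pi S.countable_toSet fun i _ => ht' i)]
  let C : Set ((ℕ → ℝ) × (Fin n → ℝ)) :=
    {z | (∀ k ∈ Finset.range K, z.1 k ∈ t' (Sum.inl k)) ∧ ∀ i, z.2 i ∈ t' (Sum.inr (Sum.inl i))}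
  have hC : MeasurableSet C := by
    refine measurableSet_setOfPred.2 (Measurable.and ?_ ?_)
    · exact Measurable.forall fun k => measurable_const.imp
        ((measurable_mem.2 (ht' _)).comp ((measurable_pi_apply k).comp measurable_fst))
    · exact Measurable.forall fun i =>
        (measurable_mem.2 (ht' _)).comp ((measurable_pi_apply i).comp measurable_snd)
  have hhist := measure_slotService_history hact hU hV hind hν hpos hslot hC
    (B := fun k => t' (Sum.inr (Sum.inr k))) (fun k => ht' _) K
  have hPC : P {ω | ((fun k => U k ω), (fun i => V i 0 ω)) ∈ C} =
      (∏ k ∈ Finset.range K, lawU k (t' (Sum.inl k))) * ∏ i, ν₀ (t' (Sum.inr (Sum.inl i))) := by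
    have hg : Function.Injective (Sum.map id fun i => (i, 0) : ℕ ⊕ Fin n → ℕ ⊕ Fin n × ℕ) :=
      Function.Injective.sumMap Function.injective_id fun i j h => (Prod.mk.inj h).1
    have h := (hind.precomp hg).measure_inter_preimage_eq_mul
      ((Finset.range K).disjSum Finset.univ)
      (sets := Sum.elim (fun k => t' (Sum.inl k)) (fun i => t' (Sum.inr (Sum.inl i))))
      (by rintro (k | i) _ <;> exact ht' _)
    rw [Finset.prod_disjSum] at h
    simp only [Sum.map_inl, Sum.map_inr, Sum.elim_inl, Sum.elim_inr, id] at h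
    have e1 : ∀ k, P (U k ⁻¹' t' (Sum.inl k)) = lawU k (t' (Sum.inl k)) := fun k =>
      (hlawU k).measure_eq (p := fun y => y ∈ t' (Sum.inl k)) (ht' _)
    have e2 : ∀ i, P (V i 0 ⁻¹' t' (Sum.inr (Sum.inl i))) = ν₀ (t' (Sum.inr (Sum.inl i))) := fun i =>
      (hν₀ i).measure_eq (p := fun y => y ∈ t' (Sum.inr (Sum.inl i))) (ht' _)
    simp only [e1, e2] at h
    rw [← h]
    congr 1
    ext ω
    simp [C, Sum.forall]
  rw [hPC] at hhist
  subst hμ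
  simp only [S, Finset.prod_disjSum, Sum.elim_inl, Sum.elim_inr]
  rw [← mul_assoc, ← hhist]
  congr 1
  ext ω
  simp [C, Set.mem_pi, Sum.forall, and_assoc]

/-! ### Time reversal of an equilibrium renewal process -/

theorem measurable_measure_Ioi (ν : Measure ℝ) : Measurable fun y => ν (Ioi y) :=
  Antitone.measurable fun _ _ h => measure_mono (Ioi_subset_Ioi h)

theorem lintegral_residualLife (ν : Measure ℝ) {f : ℝ → ENNReal} (hf : Measurable f) :
    ∫⁻ y, f y ∂(residualLife ν) =
      ∫⁻ y, (Ici 0).indicator (fun y => ν (Ioi y) / ENNReal.ofReal (∫ x, x ∂ν) * f y) y := by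
  have hd : Measurable fun y => ν (Ioi y) / ENNReal.ofReal (∫ x, x ∂ν) :=
    (measurable_measure_Ioi ν).div_const _
  rw [residualLife, lintegral_withDensity_eq_lintegral_mul _ hd hf,
    lintegral_indicator measurableSet_Ici]
  rfl

/-- The first event time and the intervals between the `m + 1` events in `[0, t]`, as seen backwards
from time `t`. -/
noncomputable def reverseIntervals (t : ℝ) {m : ℕ} (p : ℝ × (Fin m → ℝ)) : ℝ × (Fin m → ℝ) :=
  (t - (p.1 + ∑ l, p.2 l), fun l => p.2 l.rev)

theorem measurable_reverseIntervals (t : ℝ) (m : ℕ) :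
    Measurable (reverseIntervals t : ℝ × (Fin m → ℝ) → _) := by
  unfold reverseIntervals
  fun_prop

/-- The density, with respect to `dy ν(dx₁) ⋯ ν(dxₘ)`, of the first event time `y` and the intervals
`x` on the event that there are `m + 1` events in `[0, t]`. It is invariant under reversal, since the
residual life has a density proportional to the tail of `ν`. -/
noncomputable def intervalDensity (ν : Measure ℝ) (t : ℝ) {m : ℕ} (p : ℝ × (Fin m → ℝ)) : ENNReal :=
  open Classical in
  if 0 ≤ p.1 ∧ p.1 + ∑ l, p.2 l ≤ t then
    ν (Ioi p.1) / ENNReal.ofReal (∫ x, x ∂ν) * ν (Ioi (t - (p.1 + ∑ l, p.2 l))) else 0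

theorem measurable_intervalDensity (ν : Measure ℝ) (t : ℝ) (m : ℕ) :
    Measurable (intervalDensity ν t : ℝ × (Fin m → ℝ) → _) := by
  unfold intervalDensity
  have hsum : Measurable fun p : ℝ × (Fin m → ℝ) => p.1 + ∑ l, p.2 l := by fun_prop
  refine Measurable.ite ?_ ?_ measurable_const
  · exact ((measurable_const.le_prop measurable_fst).and (hsum.le_prop measurable_const)).setOf
  · exact (((measurable_measure_Ioi ν).comp measurable_fst).div_const _).mul
      ((measurable_measure_Ioi ν).comp (hsum.const_sub t))

theorem sum_rev {m : ℕ} (x : Fin m → ℝ) : ∑ l : Fin m, x l.rev = ∑ l, x l :=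
  Equiv.sum_comp Fin.revPerm x

theorem intervalDensity_reverseIntervals (ν : Measure ℝ) (t : ℝ) {m : ℕ} (p : ℝ × (Fin m → ℝ)) :
    intervalDensity ν t (reverseIntervals t p) = intervalDensity ν t p := by
  simp only [intervalDensity, reverseIntervals, sum_rev]
  have h1 : t - (t - (p.1 + ∑ l, p.2 l) + ∑ l, p.2 l) = p.1 := by ring
  have h2 : (0 ≤ t - (p.1 + ∑ l, p.2 l) ∧ t - (p.1 + ∑ l, p.2 l) + ∑ l, p.2 l ≤ t) ↔
      (0 ≤ p.1 ∧ p.1 + ∑ l, p.2 l ≤ t) := by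
    constructor <;> rintro ⟨_, _⟩ <;> constructor <;> linarith
  simp only [h1, h2]
  split_ifs
  · rw [ENNReal.div_eq_inv_mul, ENNReal.div_eq_inv_mul]
    ring
  · rfl

theorem measure_intervals_eq_lintegral (ν : Measure ℝ) [IsProbabilityMeasure ν]
    [IsProbabilityMeasure (residualLife ν)] (t : ℝ) {m : ℕ} {W : Set (ℝ × (Fin m → ℝ))}
    (hW : MeasurableSet W) :
    (((residualLife ν).prod (Measure.pi fun _ : Fin m => ν)).prod ν)
      {q | q.1 ∈ W ∧ q.1.1 + ∑ l, q.1.2 l ≤ t ∧ t < q.1.1 + ∑ l, q.1.2 l + q.2} =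
    ∫⁻ x, ∫⁻ y, intervalDensity ν t (y, x) * W.indicator 1 (y, x)
      ∂volume ∂(Measure.pi fun _ : Fin m => ν) := by
  have hsum : Measurable fun p : ℝ × (Fin m → ℝ) => p.1 + ∑ l, p.2 l := by fun_prop
  have hset : MeasurableSet {q : (ℝ × (Fin m → ℝ)) × ℝ | q.1 ∈ W ∧ q.1.1 + ∑ l, q.1.2 l ≤ t ∧
      t < q.1.1 + ∑ l, q.1.2 l + q.2} := by
    refine Measurable.setOf ?_
    exact ((measurable_mem.2 hW).comp measurable_fst).and
      (((hsum.comp measurable_fst).le_prop measurable_const).and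
        (measurable_const.lt_prop ((hsum.comp measurable_fst).add measurable_snd)))
  have hset' : MeasurableSet {p : ℝ × (Fin m → ℝ) | p ∈ W ∧ p.1 + ∑ l, p.2 l ≤ t} :=
    ((measurable_mem.2 hW).and (hsum.le_prop measurable_const)).setOf
  let f : ℝ × (Fin m → ℝ) → ENNReal := {p : ℝ × (Fin m → ℝ) | p ∈ W ∧ p.1 + ∑ l, p.2 l ≤ t}.indicator
    fun p => ν (Ioi (t - (p.1 + ∑ l, p.2 l)))
  have hf : Measurable f := ((measurable_measure_Ioi ν).comp (hsum.const_sub t)).indicator hset'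
  rw [Measure.prod_apply hset]
  have h1 : ∀ p : ℝ × (Fin m → ℝ), ν (Prod.mk p ⁻¹' {q : (ℝ × (Fin m → ℝ)) × ℝ | q.1 ∈ W ∧
      q.1.1 + ∑ l, q.1.2 l ≤ t ∧ t < q.1.1 + ∑ l, q.1.2 l + q.2}) = f p := by
    intro p
    by_cases hp : p ∈ W ∧ p.1 + ∑ l, p.2 l ≤ t
    · simp only [f]
      rw [indicator_of_mem (show p ∈ {p : ℝ × (Fin m → ℝ) | p ∈ W ∧ p.1 + ∑ l, p.2 l ≤ t} from hp)]
      congr 1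
      ext z
      simp only [mem_preimage, mem_ofPred_eq, hp.1, hp.2, true_and, mem_Ioi]
      exact ⟨fun h => by linarith, fun h => by linarith⟩
    · simp only [f]
      rw [indicator_of_notMem
        (show p ∉ {p : ℝ × (Fin m → ℝ) | p ∈ W ∧ p.1 + ∑ l, p.2 l ≤ t} from hp)]
      convert measure_empty (μ := ν)
      ext z
      simp only [mem_preimage, mem_ofPred_eq, mem_empty_iff_false, iff_false]
      exact fun h => hp ⟨h.1, h.2.1⟩
  simp only [h1]
  rw [lintegral_prod_symm _ hf.aemeasurable]
  refine lintegral_congr fun x => ?_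
  rw [lintegral_residualLife ν (f := fun y => f (y, x)) (hf.comp measurable_prodMk_right)]
  refine lintegral_congr fun y => ?_
  simp only [intervalDensity, f, indicator_apply, mem_Ici]
  by_cases h2 : 0 ≤ y <;> by_cases h3 : (y, x) ∈ W <;> by_cases h4 : y + ∑ l, x l ≤ t <;>
    simp [h2, h3, h4]

/-- The first event time and the intervals have the same law after reversal: for fixed intervals,
the first event time is reflected. -/
theorem measure_intervals_reverse (ν : Measure ℝ) [IsProbabilityMeasure ν]
    [IsProbabilityMeasure (residualLife ν)] (t : ℝ) {m : ℕ} {W : Set (ℝ × (Fin m → ℝ))}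
    (hW : MeasurableSet W) :
    (((residualLife ν).prod (Measure.pi fun _ : Fin m => ν)).prod ν)
      {q | reverseIntervals t q.1 ∈ W ∧ q.1.1 + ∑ l, q.1.2 l ≤ t ∧
        t < q.1.1 + ∑ l, q.1.2 l + q.2} =
    (((residualLife ν).prod (Measure.pi fun _ : Fin m => ν)).prod ν)
      {q | q.1 ∈ W ∧ q.1.1 + ∑ l, q.1.2 l ≤ t ∧ t < q.1.1 + ∑ l, q.1.2 l + q.2} := by
  have h := measure_intervals_eq_lintegral ν t (measurable_reverseIntervals t m hW)
  simp only [mem_preimage] at h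
  rw [h, measure_intervals_eq_lintegral ν t hW]
  let G : ℝ × (Fin m → ℝ) → ENNReal := fun p => intervalDensity ν t p * W.indicator 1 p
  have hG : Measurable G :=
    (measurable_intervalDensity ν t m).mul (measurable_one.indicator hW)
  have h1 : ∀ (y : ℝ) (x : Fin m → ℝ), intervalDensity ν t (y, x) *
      (reverseIntervals t ⁻¹' W).indicator 1 (y, x) =
        G ((t - ∑ l, x l) - y, fun l => x l.rev) := by
    intro y x
    have h2 : ((t - ∑ l, x l) - y, fun l : Fin m => x l.rev) = reverseIntervals t (y, x) := by
      simp only [reverseIntervals, Prod.mk.injEq, and_true]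
      ring
    simp only [G]
    rw [h2, intervalDensity_reverseIntervals]
    rfl
  simp only [h1]
  have h2 : ∀ x : Fin m → ℝ, ∫⁻ y, G ((t - ∑ l, x l) - y, fun l => x l.rev) =
      ∫⁻ y, G (y, fun l => x l.rev) := fun x =>
    lintegral_sub_left_eq_self (fun y => G (y, fun l => x l.rev)) _
  simp only [h2]
  have hmp : MeasurePreserving (fun (x : Fin m → ℝ) l => x l.rev)
      (Measure.pi fun _ : Fin m => ν) (Measure.pi fun _ : Fin m => ν) := by
    have := measurePreserving_piCongrLeft (fun _ : Fin m => ν) (Fin.revPerm (n := m))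
    convert this using 1
    ext x l
    simp [MeasurableEquiv.piCongrLeft, Equiv.piCongrLeft, Equiv.piCongrLeft']
    exact (eq_rec_constant _ _).symm
  exact hmp.lintegral_comp (f := fun x => ∫⁻ y, G (y, x)) hG.lintegral_prod_left'

/-- The sequence of the event times in `[0, t]`, followed by `t + 1`, when there are `m + 1` of them,
the first event time is `p.1`, and the intervals are `p.2`. -/
noncomputable def eventsOf (t : ℝ) {m : ℕ} (p : ℝ × (Fin m → ℝ)) (j : ℕ) : ℝ :=
  if j ≤ m then p.1 + ∑ l : Fin m with l.val < j, p.2 l else t + 1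

theorem measurable_eventsOf (t : ℝ) (m : ℕ) :
    Measurable (eventsOf t : ℝ × (Fin m → ℝ) → ℕ → ℝ) := by
  refine measurable_pi_lambda _ fun j => ?_
  unfold eventsOf
  split_ifs <;> fun_prop

theorem eventTime_eq_add_sum (ξ : ℕ → ℝ) {m j : ℕ} (hj : j ≤ m) :
    eventTime ξ j = ξ 0 + ∑ l : Fin m with l.val < j, ξ (l + 1) := by
  rw [eventTime, Finset.sum_range_succ', add_comm]
  congr 1
  rw [Finset.sum_filter, Fin.sum_univ_eq_sum_range (fun l => if l < j then ξ (l + 1) else 0) m,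
    ← Finset.sum_filter]
  refine Finset.sum_congr ?_ fun _ _ => rfl
  ext l
  simp only [Finset.mem_range, Finset.mem_filter]
  omega

theorem measurable_truncatedEvents {Ω : Type*} [MeasurableSpace Ω] {ξ : ℕ → Ω → ℝ}
    (hξ : ∀ k, Measurable (ξ k)) (t : ℝ) :
    Measurable fun ω => truncatedEvents t fun k => ξ k ω := by
  refine measurable_pi_lambda _ fun j => ?_
  unfold truncatedEvents
  exact Measurable.ite (measurableSet_le (measurable_eventTime hξ j) measurable_const)
    (measurable_eventTime hξ j) measurable_const

theorem measurable_reversedEvents {Ω : Type*} [MeasurableSpace Ω] {ξ : ℕ → Ω → ℝ}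
    (hξ : ∀ k, Measurable (ξ k)) (t : ℝ) :
    Measurable fun ω => reversedEvents t fun k => ξ k ω := by
  refine measurable_pi_lambda _ fun j => ?_
  have h : Measurable fun q : ℕ × Ω =>
      if j < q.1 then t - eventTime (fun k => ξ k q.2) (q.1 - 1 - j) else t + 1 := by
    refine measurable_from_prod_countable_right fun K => ?_
    simp only
    split_ifs
    · exact (measurable_eventTime hξ _).const_sub t
    · exact measurable_const
  exact h.comp ((measurable_renewalCount hξ t).prodMk measurable_id)

theorem IsRenewalPath.renewalCount_eq_iff {ξ : ℕ → ℝ} (h : IsRenewalPath ξ) (t : ℝ) (m : ℕ) :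
    renewalCount ξ t = m + 1 ↔ eventTime ξ m ≤ t ∧ t < eventTime ξ m + ξ (m + 1) := by
  rw [← eventTime_succ, h.eventTime_le_iff, ← not_le (a := eventTime ξ (m + 1)),
    h.eventTime_le_iff]
  omega

theorem truncatedEvents_eq_eventsOf {ξ : ℕ → ℝ} (h : IsRenewalPath ξ) {t : ℝ} {m : ℕ}
    (hm : renewalCount ξ t = m + 1) :
    truncatedEvents t ξ = eventsOf t (ξ 0, fun l : Fin m => ξ (l + 1)) := by
  ext j
  simp only [truncatedEvents, eventsOf, h.eventTime_le_iff, hm, Nat.lt_succ_iff]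
  split_ifs with hj
  · exact eventTime_eq_add_sum ξ hj
  · rfl

theorem reversedEvents_eq_eventsOf {ξ : ℕ → ℝ} {t : ℝ} {m : ℕ}
    (hm : renewalCount ξ t = m + 1) :
    reversedEvents t ξ = eventsOf t (reverseIntervals t (ξ 0, fun l : Fin m => ξ (l + 1))) := by
  ext j
  simp only [reversedEvents, eventsOf, reverseIntervals, hm, Nat.lt_succ_iff]
  split_ifs with hj
  · rw [Nat.add_sub_cancel, eventTime_eq_add_sum ξ (Nat.sub_le m j)]
    have h1 : ∑ l : Fin m with l.val < j, ξ (l.rev + 1) =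
        ∑ l : Fin m with ¬ l.val < m - j, ξ (l + 1) := by
      rw [Finset.sum_filter, Finset.sum_filter, ← Equiv.sum_comp Fin.revPerm]
      refine Finset.sum_congr rfl fun l _ => ?_
      have : l.rev.val < j ↔ ¬ l.val < m - j := by
        simp only [Fin.val_rev]
        omega
      simp only [Fin.revPerm_apply, Fin.rev_rev, this]
    have h2 := Finset.sum_filter_add_sum_filter_not Finset.univ (fun l : Fin m => l.val < m - j)
      (fun l => ξ (l + 1))
    rw [h1, ← h2]
    ring
  · rfl

/-- An equilibrium renewal process on `[0, t]` has the same law as its time reversal. -/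
theorem map_truncatedEvents_eq_map_reversedEvents {Ω : Type*} [MeasurableSpace Ω] {P : Measure Ω}
    [IsProbabilityMeasure P] {ν : Measure ℝ} [IsProbabilityMeasure ν]
    {ξ : ℕ → Ω → ℝ} (hξ : ∀ k, Measurable (ξ k))
    (hind : iIndepFun ξ P) (h0 : HasLaw (ξ 0) (residualLife ν) P)
    (hsucc : ∀ k, HasLaw (ξ (k + 1)) ν P) (hpath : ∀ᵐ ω ∂P, IsRenewalPath fun k => ξ k ω) (t : ℝ) :
    P.map (fun ω => truncatedEvents t fun k => ξ k ω) =
      P.map (fun ω => reversedEvents t fun k => ξ k ω) := by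
  have : IsProbabilityMeasure (residualLife ν) :=
    h0.map_eq ▸ Measure.isProbabilityMeasure_map h0.aemeasurable
  ext B hB
  rw [Measure.map_apply (measurable_truncatedEvents hξ t) hB,
    Measure.map_apply (measurable_reversedEvents hξ t) hB]
  have hcount := measurable_renewalCount hξ t
  have hsplit : ∀ A : Set Ω, MeasurableSet A →
      P A = ∑' m, P (A ∩ {ω | renewalCount (fun k => ξ k ω) t = m}) := by
    intro A hA
    rw [← measure_iUnion]
    · congr 1
      ext ω
      simp
    · refine fun m l hml => Set.disjoint_left.2 fun ω h1 h2 => hml ?_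
      exact h1.2.symm.trans h2.2
    · exact fun m => hA.inter (hcount (measurableSet_singleton m))
  rw [hsplit _ (measurable_truncatedEvents hξ t hB), hsplit _ (measurable_reversedEvents hξ t hB)]
  refine tsum_congr fun m => ?_
  rcases m with - | m
  · refine measure_congr ?_
    filter_upwards [hpath] with ω hω
    refine propext (and_congr_left fun hm => ?_)
    have hm' : renewalCount (fun k => ξ k ω) t = 0 := hm
    have : truncatedEvents t (fun k => ξ k ω) = reversedEvents t (fun k => ξ k ω) := by
      ext j
      simp [truncatedEvents, reversedEvents, hω.eventTime_le_iff, hm']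
    simp only [mem_preimage, this]
  let first : Ω → ℝ × (Fin m → ℝ) := fun ω => (ξ 0 ω, fun l => ξ (l + 1) ω)
  have hfirst : Measurable first := by
    refine (hξ 0).prodMk (measurable_pi_lambda _ fun l => hξ _)
  have hlaw1 : P.map first = (residualLife ν).prod (Measure.pi fun _ : Fin m => ν) := by
    have hx : P.map (fun ω (l : Fin m) => ξ (l + 1) ω) = Measure.pi fun _ : Fin m => ν := by
      have hg : Function.Injective fun l : Fin m => l.val + 1 := fun a b h => by
        simpa [Fin.ext_iff] using h
      rw [(hind.precomp hg).map_fun_eq_pi_map fun l => (hξ _).aemeasurable]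
      simp only [(hsucc _).map_eq]
    have h := hind.indepFun_finset {0} ((Finset.range m).image Nat.succ) (by simp) hξ
    have hφ : Measurable fun z : ({0} : Finset ℕ) → ℝ => z ⟨0, by simp⟩ := measurable_pi_apply _
    have hψ : Measurable fun (z : (Finset.range m).image Nat.succ → ℝ) (l : Fin m) =>
        z ⟨l + 1, by simp⟩ := measurable_pi_lambda _ fun l => measurable_pi_apply _
    have h' := h.comp hφ hψ
    rw [← h0.map_eq, ← hx]
    exact (indepFun_iff_map_prod_eq_prod_map_map (hξ 0).aemeasurable
      (measurable_pi_lambda _ fun l : Fin m => hξ _).aemeasurable).1 h'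
  have hlaw : P.map (fun ω => (first ω, ξ (m + 1) ω)) =
      ((residualLife ν).prod (Measure.pi fun _ : Fin m => ν)).prod ν := by
    have h := hind.indepFun_finset (Finset.range (m + 1)) {m + 1} (by simp) hξ
    have hφ : Measurable fun z : Finset.range (m + 1) → ℝ =>
        (z ⟨0, by simp⟩, fun l : Fin m => z ⟨l + 1, by simp⟩) :=
      (measurable_pi_apply _).prodMk (measurable_pi_lambda _ fun l => measurable_pi_apply _)
    have hψ : Measurable fun z : ({m + 1} : Finset ℕ) → ℝ => z ⟨m + 1, by simp⟩ :=
      measurable_pi_apply _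
    have h' := h.comp hφ hψ
    refine ((indepFun_iff_map_prod_eq_prod_map_map hfirst.aemeasurable
      (hξ _).aemeasurable).1 h').trans ?_
    change (P.map first).prod (P.map (ξ (m + 1))) = _
    rw [hlaw1, (hsucc m).map_eq]
  have hsum : Measurable fun p : ℝ × (Fin m → ℝ) => p.1 + ∑ l, p.2 l := by fun_prop
  -- The two events in terms of the first event time and the intervals.
  have key : ∀ W : Set (ℝ × (Fin m → ℝ)), MeasurableSet W →
      P {ω | first ω ∈ W ∧ renewalCount (fun k => ξ k ω) t = m + 1} =
        (((residualLife ν).prod (Measure.pi fun _ : Fin m => ν)).prod ν)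
          {q | q.1 ∈ W ∧ q.1.1 + ∑ l, q.1.2 l ≤ t ∧ t < q.1.1 + ∑ l, q.1.2 l + q.2} := by
    intro W hW
    rw [← hlaw, Measure.map_apply (hfirst.prodMk (hξ _))]
    · refine measure_congr ?_
      filter_upwards [hpath] with ω hω
      refine propext (and_congr_right fun _ => ?_)
      rw [hω.renewalCount_eq_iff, eventTime_eq_add_sum _ (le_refl m)]
      simp [first]
    · refine Measurable.setOf ?_
      exact ((measurable_mem.2 hW).comp measurable_fst).and
        (((hsum.comp measurable_fst).le_prop measurable_const).and
          (measurable_const.lt_prop ((hsum.comp measurable_fst).add measurable_snd)))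
  have hW := measurable_eventsOf t m hB
  calc P ((fun ω => truncatedEvents t fun k => ξ k ω) ⁻¹' B ∩
        {ω | renewalCount (fun k => ξ k ω) t = m + 1})
      = P {ω | first ω ∈ eventsOf t ⁻¹' B ∧ renewalCount (fun k => ξ k ω) t = m + 1} := by
        refine measure_congr ?_
        filter_upwards [hpath] with ω hω
        refine propext (and_congr_left fun hm => ?_)
        simp only [mem_preimage, truncatedEvents_eq_eventsOf hω hm, first]
    _ = P {ω | first ω ∈ reverseIntervals t ⁻¹' (eventsOf t ⁻¹' B) ∧
          renewalCount (fun k => ξ k ω) t = m + 1} := by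
        rw [key _ hW, key _ (measurable_reverseIntervals t m hW)]
        exact (measure_intervals_reverse ν t hW).symm
    _ = P ((fun ω => reversedEvents t fun k => ξ k ω) ⁻¹' B ∩
          {ω | renewalCount (fun k => ξ k ω) t = m + 1}) := by
        congr 1
        ext ω
        refine and_congr_left fun hm => ?_
        simp only [mem_preimage, reversedEvents_eq_eventsOf hm, first]

/-! ### Almost sure properties of renewal processes -/

theorem ae_pos_residualLife (ν : Measure ℝ) : ∀ᵐ y ∂(residualLife ν), 0 < y := by
  refine (withDensity_absolutelyContinuous _ _).ae_le ?_
  rw [Measure.restrict_congr_set Ioi_ae_eq_Ici.symm]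
  exact ae_restrict_mem measurableSet_Ioi

theorem ae_isRenewalPath {Ω : Type*} [MeasurableSpace Ω] {P : Measure Ω}
    [IsProbabilityMeasure P] {ν : Measure ℝ} [IsProbabilityMeasure ν]
    (hpos : ∀ᵐ y ∂ν, 0 < y) (hint : Integrable (fun y => y) ν) {ξ : ℕ → Ω → ℝ}
    (hind : iIndepFun ξ P) (h0 : HasLaw (ξ 0) (residualLife ν) P)
    (hsucc : ∀ k, HasLaw (ξ (k + 1)) ν P) : ∀ᵐ ω ∂P, IsRenewalPath fun k => ξ k ω := by
  have hpos0 : ∀ᵐ ω ∂P, 0 < ξ 0 ω :=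
    ae_of_ae_map h0.aemeasurable (by rw [h0.map_eq]; exact ae_pos_residualLife ν)
  have hpos1 : ∀ᵐ ω ∂P, ∀ k, 0 < ξ (k + 1) ω := ae_all_iff.2 fun k =>
    ae_of_ae_map (hsucc k).aemeasurable (by rw [(hsucc k).map_eq]; exact hpos)
  have hint1 : Integrable (ξ 1) P := by
    have h := hint
    rw [← (hsucc 0).map_eq] at h
    exact h.comp_aemeasurable (hsucc 0).aemeasurable
  have hmean : 0 < ∫ ω, ξ 1 ω ∂P := by
    have hpos' : ∀ᵐ ω ∂P, 0 < ξ 1 ω := hpos1.mono fun ω h => h 0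
    rw [integral_pos_iff_support_of_nonneg_ae (hpos'.mono fun ω h => h.le) hint1]
    have : Function.support (ξ 1) =ᵐ[P] univ := by
      filter_upwards [hpos'] with ω h
      exact propext ⟨fun _ => trivial, fun _ => h.ne'⟩
    rw [measure_congr this]
    simp
  have hlln := strong_law_ae_real (fun k => ξ (k + 1)) hint1
    (fun k l hkl => hind.indepFun (by simpa using hkl))
    (fun k => ⟨(hsucc k).aemeasurable, (hsucc 0).aemeasurable,
      (hsucc k).map_eq.trans (hsucc 0).map_eq.symm⟩)
  filter_upwards [hpos0, hpos1, hlln] with ω h1 h2 h3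
  refine ⟨fun k => ?_, ?_⟩
  · cases k with
    | zero => exact h1
    | succ k => exact h2 k
  · have h4 := h3.pos_mul_atTop hmean (tendsto_natCast_atTop_atTop (R := ℝ))
    refine tendsto_atTop_mono' _ ?_ h4
    filter_upwards [eventually_gt_atTop 0] with k hk
    rw [div_mul_cancel₀ _ (by positivity), eventTime, Finset.sum_range_succ']
    linarith

/-! ### Time reversal of all processes together -/

theorem measurable_quietCount {Ω : Type*} [MeasurableSpace Ω] {n : ℕ} {b : Fin n → ℕ → Ω → ℝ}
    (hb : ∀ i m, Measurable (b i m)) (δ : ℝ) (η : ℕ) :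
    Measurable fun ω => quietCount δ η fun i m => b i m ω := by
  unfold quietCount
  refine Finset.measurable_sum _ fun i _ => Measurable.ite ?_ measurable_const measurable_const
  exact measurable_ncard_setOf (fun m => (hb i m).le_prop measurable_const) (measurableSet_singleton 0)

theorem measurable_boundExceeds {Ω : Type*} [MeasurableSpace Ω] {n : ℕ} {a : ℕ → Ω → ℝ}
    {b : Fin n → ℕ → Ω → ℝ} (ha : ∀ j, Measurable (a j)) (hb : ∀ i m, Measurable (b i m))
    (t δ : ℝ) (η : ℕ) (y : ℝ) :
    Measurable fun ω => BoundExceeds t δ η y (fun j => a j ω) (fun i m => b i m ω) := by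
  have hquiet := measurable_quietCount hb δ η
  have hδ : ∀ i, Measurable fun ω => ({m | b i m ω ≤ δ}.ncard : ℝ) := fun i =>
    measurable_from_nat.comp (measurable_ncard_setOf fun m => (hb i m).le_prop measurable_const)
  have hj : ∀ i j, Measurable fun ω => ({m | b i m ω ≤ a j ω}.ncard : ℝ) := fun i j =>
    measurable_from_nat.comp (measurable_ncard_setOf fun m => (hb i m).le_prop (ha j))
  refine (measurable_const.lt_prop hquiet).or (Measurable.exists fun j =>
    ((ha j).le_prop measurable_const).and (measurable_const.lt_prop ?_))
  refine (measurable_const.sub (Measurable.ite (measurableSet_le (ha j) measurable_const) ?_ ?_)).add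
    hquiet
  · exact Finset.measurable_sum _ fun i _ => hj i j
  · exact (Finset.measurable_sum _ fun i _ => hj i j).sub (Finset.measurable_sum _ fun i _ => hδ i)

/-- Independent processes that are sequences of independent variables, from the independence of all
the variables. -/
theorem iIndepFun_sequences {Ω κ : Type*} [MeasurableSpace Ω] [Fintype κ] {P : Measure Ω}
    {X : κ → ℕ → Ω → ℝ} (hX : ∀ a k, Measurable (X a k))
    (hind : iIndepFun (fun p : κ × ℕ => X p.1 p.2) P) :
    iIndepFun (fun a ω k => X a k ω) P := by
  have := hind.isProbabilityMeasure
  have hprob : ∀ a k, IsProbabilityMeasure (P.map (X a k)) := fun a k =>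
    Measure.isProbabilityMeasure_map (hX a k).aemeasurable
  rw [iIndepFun_iff_map_fun_eq_pi_map
    (fun a => (measurable_pi_lambda _ fun k => hX a k).aemeasurable)]
  have h1 : ∀ a, P.map (fun ω k => X a k ω) = Measure.infinitePi fun k => P.map (X a k) := fun a =>
    (hind.precomp (Prod.mk_right_injective a)).map_fun_eq_infinitePi_map (hX a)
  have h2 := hind.map_fun_eq_infinitePi_map fun p : κ × ℕ => hX p.1 p.2
  simp only [h1]
  rw [← Measure.infinitePi_eq_pi, ← Measure.infinitePi_map_curry (fun a k => P.map (X a k)), ← h2,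
    Measure.map_map (MeasurableEquiv.measurable _)
      (measurable_pi_lambda _ fun p : κ × ℕ => hX p.1 p.2)]
  rfl

theorem measure_boundExceeds_reversedEvents {Ω : Type*} [MeasurableSpace Ω] {P : Measure Ω}
    [IsProbabilityMeasure P] {n : ℕ} {lawA lawS : Measure ℝ} [IsProbabilityMeasure lawA]
    [IsProbabilityMeasure lawS] {U : ℕ → Ω → ℝ} {V : Fin n → ℕ → Ω → ℝ}
    (hU : ∀ k, Measurable (U k)) (hV : ∀ i k, Measurable (V i k))
    (hU_zero : HasLaw (U 0) (residualLife lawA) P) (hU_succ : ∀ k, HasLaw (U (k + 1)) lawA P)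
    (hV_zero : ∀ i, HasLaw (V i 0) (residualLife lawS) P)
    (hV_succ : ∀ i k, HasLaw (V i (k + 1)) lawS P)
    (hind : iIndepFun (Sum.elim U (fun p : Fin n × ℕ => V p.1 p.2)) P)
    (hUpath : ∀ᵐ ω ∂P, IsRenewalPath fun k => U k ω)
    (hVpath : ∀ i, ∀ᵐ ω ∂P, IsRenewalPath fun k => V i k ω) (t δ : ℝ) (η : ℕ) (y : ℝ) :
    P {ω | BoundExceeds t δ η y (reversedEvents t fun k => U k ω)
        (fun i => reversedEvents t fun k => V i k ω)} =
      P {ω | BoundExceeds t δ η y (truncatedEvents t fun k => U k ω)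
        (fun i => truncatedEvents t fun k => V i k ω)} := by
  let X : Option (Fin n) → ℕ → Ω → ℝ := fun a => a.elim U V
  have hX : ∀ a k, Measurable (X a k) := by
    rintro (_ | i) k
    · exact hU k
    · exact hV i k
  have hXind : iIndepFun (fun p : Option (Fin n) × ℕ => X p.1 p.2) P := by
    let g : Option (Fin n) × ℕ → ℕ ⊕ Fin n × ℕ := fun p =>
      p.1.elim (Sum.inl p.2) fun i => Sum.inr (i, p.2)
    have hg : Function.Injective g := by
      rintro ⟨_ | i, k⟩ ⟨_ | j, l⟩ h <;> simp_all [g]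
    have heq : (fun p : Option (Fin n) × ℕ => X p.1 p.2) =
        fun p => Sum.elim U (fun p : Fin n × ℕ => V p.1 p.2) (g p) := by
      ext ⟨_ | i, k⟩ ω <;> rfl
    rw [heq]
    have h := hind.precomp hg
    convert h using 1
  have hseq := iIndepFun_sequences hX hXind
  have htr : ∀ a, Measurable fun ω => truncatedEvents t fun k => X a k ω := fun a =>
    measurable_truncatedEvents (hX a) t
  have hrev : ∀ a, Measurable fun ω => reversedEvents t fun k => X a k ω := fun a =>
    measurable_reversedEvents (hX a) t
  have h1 := (hseq.comp (fun _ => truncatedEvents t) fun _ =>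
    measurable_truncatedEvents (ξ := fun k (z : ℕ → ℝ) => z k) measurable_pi_apply t).map_fun_eq_pi_map
      fun a => (htr a).aemeasurable
  have h2 := (hseq.comp (fun _ => reversedEvents t) fun _ =>
    measurable_reversedEvents (ξ := fun k (z : ℕ → ℝ) => z k) measurable_pi_apply t).map_fun_eq_pi_map
      fun a => (hrev a).aemeasurable
  have hindU : iIndepFun U P := hind.precomp (g := Sum.inl) Sum.inl_injective
  have hindV : ∀ i, iIndepFun (V i) P := fun i =>
    hind.precomp (g := fun k => Sum.inr (i, k))
      (Sum.inr_injective.comp (Prod.mk_right_injective i))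
  have h3 : ∀ a, P.map (truncatedEvents t ∘ fun ω k => X a k ω) =
      P.map (reversedEvents t ∘ fun ω k => X a k ω) := by
    rintro (_ | i)
    · exact map_truncatedEvents_eq_map_reversedEvents hU
        hindU hU_zero hU_succ hUpath t
    · exact map_truncatedEvents_eq_map_reversedEvents (hV i)
        (hindV i) (hV_zero i) (hV_succ i) (hVpath i) t
  let S : Set (Option (Fin n) → ℕ → ℝ) :=
    {w | BoundExceeds t δ η y (w none) (fun i => w (some i))}
  have hS : MeasurableSet S :=
    (measurable_boundExceeds (a := fun j (w : Option (Fin n) → ℕ → ℝ) => w none j)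
      (b := fun i m (w : Option (Fin n) → ℕ → ℝ) => w (some i) m)
      (fun j => (measurable_pi_apply j).comp (measurable_pi_apply _))
      (fun i m => (measurable_pi_apply m).comp (measurable_pi_apply _)) t δ η y).setOf
  have h4 : P.map (fun ω a => reversedEvents t fun k => X a k ω) =
      P.map (fun ω a => truncatedEvents t fun k => X a k ω) :=
    h2.trans ((congrArg Measure.pi (funext h3)).symm.trans h1.symm)
  have h5 : P.map (fun ω a => reversedEvents t fun k => X a k ω) S =
      P.map (fun ω a => truncatedEvents t fun k => X a k ω) S := by rw [h4]
  rw [Measure.map_apply (measurable_pi_lambda _ hrev) hS,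
    Measure.map_apply (measurable_pi_lambda _ htr) hS] at h5
  exact h5

/-! ### The bound in terms of the counting processes -/

theorem lt_add_of_coe_le {M : EReal} {c q y : ℝ} (hc : (c : EReal) ≤ M) (hy : y < c + q) :
    (y : EReal) < M + (q : EReal) := by
  refine lt_of_lt_of_le (EReal.coe_lt_coe_iff.2 hy) ?_
  rw [EReal.coe_add]
  gcongr

theorem ncard_truncatedEvents_le {ξ : ℕ → ℝ} {s t : ℝ} (hs : s ≤ t) :
    {m | truncatedEvents t ξ m ≤ s}.ncard = renewalCount ξ s := by
  unfold renewalCount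
  congr 1
  ext m
  simp only [mem_ofPred_eq, truncatedEvents]
  split_ifs with h
  · rfl
  · constructor <;> intro h' <;> linarith

theorem lt_upperBoundVar_of_boundExceeds {n : ℕ} {U : ℕ → ℝ} {V : Fin n → ℕ → ℝ} {t δ y : ℝ} {η : ℕ}
    (h0 : 0 ≤ δ) (hδ : δ ≤ t) (hU : IsRenewalPath U) (hV : ∀ i, IsRenewalPath (V i))
    (h : BoundExceeds t δ η y (truncatedEvents t U) (fun i => truncatedEvents t (V i))) :
    (y : EReal) < upperBoundVar (renewalCount U) (fun i => renewalCount (V i)) δ η (Icc δ t) := by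
  have hquiet : quietCount δ η (fun i => truncatedEvents t (V i)) =
      ∑ i with η ≤ i.val, (if renewalCount (V i) δ = 0 then 1 else 0 : ℝ) := by
    unfold quietCount
    refine Finset.sum_congr rfl fun i _ => ?_
    rw [ncard_truncatedEvents_le hδ]
  have hcount : ∀ i s, s ≤ t → {m | truncatedEvents t (V i) m ≤ s}.ncard =
      renewalCount (V i) s := fun i s hs => ncard_truncatedEvents_le hs
  have hδcount : ∀ i, {m | truncatedEvents t (V i) m ≤ δ}.ncard = renewalCount (V i) δ :=
    fun i => hcount i δ hδ
  -- A lower bound by the value at one time `s` in the first supremum.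
  have hfirst : ∀ s ∈ Icc 0 δ, ((1 + ((renewalCount U s : ℝ) -
      ∑ i with i.val < η, (renewalCount (V i) s : ℝ)) : ℝ) : EReal) ≤
      1 + ⨆ s ∈ Icc 0 δ, (((renewalCount U s : ℝ) -
        ∑ i with i.val < η, (renewalCount (V i) s : ℝ) : ℝ) : EReal) := by
    intro s hs
    rw [EReal.coe_add, EReal.coe_one]
    gcongr
    exact le_iSup₂_of_le s hs le_rfl
  unfold upperBoundVar
  rcases h with h | ⟨j, hj, h⟩
  · rw [hquiet] at h
    refine lt_add_of_coe_le (c := 0) ?_ (by rwa [zero_add])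
    refine le_max_of_le_left (le_trans (EReal.coe_le_coe_iff.2 ?_) (hfirst 0 ⟨le_rfl, h0⟩))
    have : ∀ i, renewalCount (V i) 0 = 0 := by
      intro i
      by_contra hne
      exact absurd (((hV i).eventTime_le_iff 0 0).2 (Nat.pos_of_ne_zero hne))
        (not_le.2 (eventTime_pos (hV i).pos 0))
    simp only [this, Nat.cast_zero, Finset.sum_const_zero, sub_zero]
    positivity
  · have hs : truncatedEvents t U j = eventTime U j := by
      unfold truncatedEvents at hj ⊢
      split_ifs at hj ⊢ with h'
      · rfl
      · linarith
    rw [hs] at h hj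
    set s := eventTime U j with hsdef
    have hs0 : 0 < s := eventTime_pos hU.pos j
    have hA : (j : ℝ) + 1 ≤ renewalCount U s := by
      have := (hU.eventTime_le_iff s j).1 le_rfl
      exact_mod_cast this
    simp only [hquiet, hδcount, hcount _ s hj] at h
    split_ifs at h with hcase
    · refine lt_add_of_coe_le (le_max_of_le_left (hfirst s ⟨hs0.le, hcase⟩)) ?_
      linarith
    · refine lt_add_of_coe_le (c := ((renewalCount U s : ℝ) - ∑ i, (renewalCount (V i) s : ℝ)) +
        ∑ i with η ≤ i.val, (renewalCount (V i) δ : ℝ)) (le_max_of_le_right ?_) (by linarith)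
      rw [EReal.coe_add]
      gcongr
      exact le_iSup₂_of_le (f := fun s (_ : s ∈ Icc δ t) => (((renewalCount U s : ℝ) -
        ∑ i, (renewalCount (V i) s : ℝ) : ℝ) : EReal)) s ⟨(not_le.1 hcase).le, hj⟩ le_rfl

theorem upperBoundVar_mono {n : ℕ} (A : ℝ → ℕ) (N : Fin n → ℝ → ℕ) (δ : ℝ) (η : ℕ) {J J' : Set ℝ}
    (h : J ⊆ J') : upperBoundVar A N δ η J ≤ upperBoundVar A N δ η J' := by
  have hsup : (⨆ s ∈ J, (((A s : ℝ) - ∑ i, (N i s : ℝ) : ℝ) : EReal)) ≤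
      ⨆ s ∈ J', (((A s : ℝ) - ∑ i, (N i s : ℝ) : ℝ) : EReal) := biSup_mono fun s hs => h hs
  unfold upperBoundVar
  gcongr

/-! ### The bound in distribution -/

theorem measurableSet_lt_numberInSystem {n : ℕ} (t x : ℝ) :
    MeasurableSet {z : ℕ ⊕ Fin n ⊕ ℕ → ℝ | x < numberInSystem (fun i => z (Sum.inr (Sum.inl i)))
      (eventTime fun k => z (Sum.inl k)) (fun k => z (Sum.inr (Sum.inr k))) t} := by
  refine Measurable.setOf (measurable_const.lt_prop (measurable_from_nat.comp ?_))
  exact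
    measurable_numberInSystem (W := fun (z : ℕ ⊕ Fin n ⊕ ℕ → ℝ) i => z (Sum.inr (Sum.inl i)))
      (T := fun k z => eventTime (fun j => z (Sum.inl j)) k)
      (S := fun k z => z (Sum.inr (Sum.inr k)))
      (fun i => measurable_pi_apply _)
      (fun k => measurable_eventTime (fun j => measurable_pi_apply _) k)
      (fun k => measurable_pi_apply _) t

/-- The bound for the canonical queue, driven by independent variables with the laws of the theorem:
couple it with the dominating schedule, bound pathwise, and reverse time. -/
theorem measure_lt_numberInSystem_le {Ω : Type*} [MeasurableSpace Ω] {P : Measure Ω}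
    [IsProbabilityMeasure P] {n : ℕ} (hn : 0 < n) {lawA lawS : Measure ℝ}
    [IsProbabilityMeasure lawA] [IsProbabilityMeasure lawS] {U : ℕ → Ω → ℝ} {V : Fin n → ℕ → Ω → ℝ}
    (hU : ∀ k, Measurable (U k)) (hV : ∀ i k, Measurable (V i k))
    (hU_zero : HasLaw (U 0) (residualLife lawA) P) (hU_succ : ∀ k, HasLaw (U (k + 1)) lawA P)
    (hV_zero : ∀ i, HasLaw (V i 0) (residualLife lawS) P)
    (hV_succ : ∀ i k, HasLaw (V i (k + 1)) lawS P)
    (hind : iIndepFun (Sum.elim U (fun p : Fin n × ℕ => V p.1 p.2)) P)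
    (hUpath : ∀ᵐ ω ∂P, IsRenewalPath fun k => U k ω)
    (hVpath : ∀ i, ∀ᵐ ω ∂P, IsRenewalPath fun k => V i k ω)
    (μ : ℕ ⊕ Fin n ⊕ ℕ → Measure ℝ) [∀ i, IsProbabilityMeasure (μ i)]
    (hμ : μ = Sum.elim (fun k => P.map (U k)) (Sum.elim (fun _ => residualLife lawS) fun _ => lawS))
    {t δ : ℝ} (hδ : δ ≤ t) (η : ℕ) (x : ℝ) :
    Measure.infinitePi μ {z | x < numberInSystem (fun i => z (Sum.inr (Sum.inl i)))
        (eventTime fun k => z (Sum.inl k)) (fun k => z (Sum.inr (Sum.inr k))) t} ≤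
      P {ω | BoundExceeds t δ η (x - η) (truncatedEvents t fun k => U k ω)
        (fun i => truncatedEvents t fun k => V i k ω)} := by
  let act : Fin n → ℝ → Prop := fun i s => s < t - δ ∨ i.val < η ∨ t < s
  have hact : ∀ i, Measurable (act i) := fun i =>
    (measurable_id.lt_prop measurable_const).or
      (measurable_const.or (measurable_const.lt_prop measurable_id))
  have hVpath' : ∀ᵐ ω ∂P, ∀ i, IsRenewalPath fun k => V i k ω := ae_all_iff.2 hVpath
  have hslot : ∀ᵐ ω ∂P, ∀ k,
      ∃ p, IsSlot act (eventTime fun k => U k ω) (fun i k => V i k ω) k p := by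
    filter_upwards [hVpath'] with ω hω
    exact exists_isSlot hn hω fun i s hs => Or.inr (Or.inr hs)
  have : ∀ k, IsProbabilityMeasure (P.map (U k)) := fun k =>
    Measure.isProbabilityMeasure_map (hU k).aemeasurable
  have : IsProbabilityMeasure (residualLife lawS) :=
    (hV_zero ⟨0, hn⟩).map_eq ▸ Measure.isProbabilityMeasure_map (hV _ _).aemeasurable
  have hlaw := hasLaw_slotService hact hU hV hind (fun k => ⟨(hU k).aemeasurable, rfl⟩) hV_zero
    hV_succ (hVpath'.mono fun ω h i => (h i).pos) hslot μ hμ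
  rw [← hlaw.measure_eq (measurableSet_lt_numberInSystem t x),
    ← measure_boundExceeds_reversedEvents hU hV hU_zero hU_succ hV_zero hV_succ hind hUpath hVpath]
  refine measure_mono_ae ?_
  filter_upwards [hUpath, hVpath', hslot] with ω h1 h2 h3 hx
  choose I hI using h3
  refine boundExceeds_of_lt_numberInSystem hδ h1 h2 hI (lt_of_lt_of_eq hx ?_)
  congr 2
  ext k
  exact (hI k).slotService_eq fun i => (h2 i).pos

theorem measure_lt_numberInSystem_le_upperBoundVar {Ω : Type*} [MeasurableSpace Ω] (P : Measure Ω)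
    [IsProbabilityMeasure P] {n : ℕ} (hn : 1 ≤ n) (lawA lawS : Measure ℝ)
    [IsProbabilityMeasure lawA] [IsProbabilityMeasure lawS]
    (hA_pos : ∀ᵐ y ∂lawA, 0 < y) (hS_pos : ∀ᵐ y ∂lawS, 0 < y)
    (hA_int : Integrable (fun y => y) lawA) (hS_int : Integrable (fun y => y) lawS)
    (U : ℕ → Ω → ℝ) (V : Fin n → ℕ → Ω → ℝ) (σ : ℕ → Ω → ℝ)
    (hU_zero : HasLaw (U 0) (residualLife lawA) P)
    (hU_succ : ∀ k, HasLaw (U (k + 1)) lawA P)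
    (hV_zero : ∀ i, HasLaw (V i 0) (residualLife lawS) P)
    (hV_succ : ∀ i k, HasLaw (V i (k + 1)) lawS P)
    (hσ : ∀ k, HasLaw (σ k) lawS P)
    (h_indep_renewal : iIndepFun (Sum.elim U (fun p : Fin n × ℕ => V p.1 p.2)) P)
    (h_indep_queue : iIndepFun (Sum.elim U (Sum.elim (fun i : Fin n => V i 0) σ)) P)
    {t δ : ℝ} (h0 : 0 ≤ δ) (hδ : δ ≤ t) (η : ℕ) (x : ℝ) :
    P {ω | x < (numberInSystem (fun i => V i 0 ω) (eventTime fun k => U k ω)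
      (fun k => σ k ω) t : ℝ)} ≤
    P {ω | ((x - η : ℝ) : EReal) < upperBoundVar (renewalCount fun k => U k ω)
      (fun i => renewalCount fun k => V i k ω) δ η (Icc δ t)} := by
  have hUm : ∀ k, AEMeasurable (U k) P := by
    rintro (_ | k)
    · exact hU_zero.aemeasurable
    · exact (hU_succ k).aemeasurable
  have hVm : ∀ i k, AEMeasurable (V i k) P := by
    rintro i (_ | k)
    · exact (hV_zero i).aemeasurable
    · exact (hV_succ i k).aemeasurable
  have hUpath : ∀ᵐ ω ∂P, IsRenewalPath fun k => U k ω :=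
    ae_isRenewalPath hA_pos hA_int
      (h_indep_renewal.precomp (g := Sum.inl) Sum.inl_injective) hU_zero hU_succ
  have hVpath : ∀ i, ∀ᵐ ω ∂P, IsRenewalPath fun k => V i k ω := fun i =>
    ae_isRenewalPath hS_pos hS_int
      (h_indep_renewal.precomp (g := fun k => Sum.inr (i, k))
        (Sum.inr_injective.comp (Prod.mk_right_injective i))) (hV_zero i) (hV_succ i)
  -- Measurable versions of the intervals.
  let U' : ℕ → Ω → ℝ := fun k => (hUm k).mk
  let V' : Fin n → ℕ → Ω → ℝ := fun i k => (hVm i k).mk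
  have hU' : ∀ k, U k =ᵐ[P] U' k := fun k => (hUm k).ae_eq_mk
  have hV' : ∀ i k, V i k =ᵐ[P] V' i k := fun i k => (hVm i k).ae_eq_mk
  have hU'ae : ∀ᵐ ω ∂P, (fun k => U k ω) = fun k => U' k ω :=
    (ae_all_iff.2 hU').mono fun ω h => funext h
  have hV'ae : ∀ᵐ ω ∂P, ∀ i, (fun k => V i k ω) = fun k => V' i k ω :=
    (ae_all_iff.2 fun i => ae_all_iff.2 (hV' i)).mono fun ω h i => funext (h i)
  have hind' : iIndepFun (Sum.elim U' (fun p : Fin n × ℕ => V' p.1 p.2)) P := by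
    refine h_indep_renewal.congr ?_
    rintro (k | p)
    · exact hU' k
    · exact hV' p.1 p.2
  have : ∀ k, IsProbabilityMeasure (P.map (U' k)) := fun k =>
    Measure.isProbabilityMeasure_map (hUm k).measurable_mk.aemeasurable
  have : IsProbabilityMeasure (residualLife lawS) :=
    (hV_zero ⟨0, hn⟩).map_eq ▸ Measure.isProbabilityMeasure_map (hVm _ _)
  let μ : ℕ ⊕ Fin n ⊕ ℕ → Measure ℝ :=
    Sum.elim (fun k => P.map (U' k)) (Sum.elim (fun _ => residualLife lawS) fun _ => lawS)
  have hμ : ∀ i, IsProbabilityMeasure (μ i) := by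
    rintro (k | i | k)
    · exact inferInstanceAs (IsProbabilityMeasure (P.map (U' k)))
    · exact inferInstanceAs (IsProbabilityMeasure (residualLife lawS))
    · exact inferInstanceAs (IsProbabilityMeasure lawS)
  have hXlaw : ∀ i, HasLaw (Sum.elim U (Sum.elim (fun i : Fin n => V i 0) σ) i) (μ i) P := by
    rintro (k | i | k)
    · exact ⟨hUm k, Measure.map_congr (hU' k)⟩
    · exact hV_zero i
    · exact hσ k
  have hlaw := h_indep_queue.hasLaw_infinitePi hXlaw
    (aemeasurable_pi_lambda _ fun i => (hXlaw i).aemeasurable)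
  refine (hlaw.measure_eq (measurableSet_lt_numberInSystem t x)).le.trans
    ((measure_lt_numberInSystem_le hn (fun k => (hUm k).measurable_mk)
      (fun i k => (hVm i k).measurable_mk) (hU_zero.congr (hU' 0).symm)
      (fun k => (hU_succ k).congr (hU' _).symm) (fun i => (hV_zero i).congr (hV' i 0).symm)
      (fun i k => (hV_succ i k).congr (hV' i _).symm) hind' ?_ ?_ μ rfl hδ η x).trans ?_)
  · filter_upwards [hUpath, hU'ae] with ω h1 h2
    exact h2 ▸ h1
  · intro i
    filter_upwards [hVpath i, hV'ae] with ω h1 h2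
    exact h2 i ▸ h1
  · refine measure_mono_ae ?_
    filter_upwards [hUpath, ae_all_iff.2 hVpath, hU'ae, hV'ae] with ω h1 h2 h3 h4 hω
    refine lt_upperBoundVar_of_boundExceeds h0 hδ h1 h2 ?_
    simp only [h3, h4]
    exact hω

theorem theorem4 {Ω : Type*} [MeasurableSpace Ω] (P : Measure Ω) [IsProbabilityMeasure P]
    (n : ℕ) (hn : 1 ≤ n)
    -- the laws of the inter-arrival time and of the processing time
    (lawA lawS : Measure ℝ) [IsProbabilityMeasure lawA] [IsProbabilityMeasure lawS]
    (hA_pos : ∀ᵐ y ∂lawA, 0 < y) (hS_pos : ∀ᵐ y ∂lawS, 0 < y)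
    (hA_int : Integrable (fun y => y) lawA) (hS_int : Integrable (fun y => y) lawS)
    -- `U`: intervals of the process `A(t)`; `V i`: intervals of the process `N_i(t)`;
    -- `σ k`: processing time of the `(k+1)`-st job to arrive to the queue after time `0`
    (U : ℕ → Ω → ℝ) (V : Fin n → ℕ → Ω → ℝ) (σ : ℕ → Ω → ℝ)
    (hU_zero : HasLaw (U 0) (residualLife lawA) P)
    (hU_succ : ∀ k, HasLaw (U (k + 1)) lawA P)
    (hV_zero : ∀ i, HasLaw (V i 0) (residualLife lawS) P)
    (hV_succ : ∀ i k, HasLaw (V i (k + 1)) lawS P)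
    (hσ : ∀ k, HasLaw (σ k) lawS P)
    -- the `n + 1` equilibrium renewal processes are independent
    (h_indep_renewal :
      iIndepFun (Sum.elim U (fun p : Fin n × ℕ => V p.1 p.2)) P)
    -- arrivals, initial processing times and later processing times are independent
    (h_indep_queue :
      iIndepFun (Sum.elim U (Sum.elim (fun i : Fin n => V i 0) σ)) P)
    (A : Ω → ℝ → ℕ) (hA : A = fun ω => renewalCount (fun k => U k ω))
    (N : Ω → Fin n → ℝ → ℕ) (hN : N = fun ω i => renewalCount (fun k => V i k ω))
    (Q : ℝ → Ω → ℕ)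
    (hQ : Q = fun t ω => numberInSystem (fun i => V i 0 ω) (eventTime fun k => U k ω)
      (fun k => σ k ω) t) :
    (∀ t x : ℝ, 0 ≤ t → 0 ≤ x →
      P {ω | x < (Q t ω : ℝ)} ≤
        ⨅ δ ∈ Icc (0 : ℝ) t, ⨅ η ∈ Icc (0 : ℕ) n,
          P {ω | ((x - η : ℝ) : EReal) < upperBoundVar (A ω) (N ω) δ η (Icc δ t)}) ∧
    (∀ (Ω' : Type*) [MeasurableSpace Ω'] (P' : Measure Ω') [IsProbabilityMeasure P']
        (Qinf : Ω' → ℝ),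
      TendstoInDistribution (fun (t : ℝ) ω => (Q t ω : ℝ)) atTop Qinf (fun _ => P) P' →
      ∀ x : ℝ, 0 < x →
        P' {ω' | x < Qinf ω'} ≤
          ⨅ δ ∈ Ici (0 : ℝ), ⨅ η ∈ Icc (0 : ℕ) n,
            P {ω | ((x - η : ℝ) : EReal) < upperBoundVar (A ω) (N ω) δ η (Ici δ)}) := by

  have bound : ∀ t δ x : ℝ, 0 ≤ δ → δ ≤ t → ∀ η : ℕ, P {ω | x < (Q t ω : ℝ)} ≤
      P {ω | ((x - η : ℝ) : EReal) < upperBoundVar (A ω) (N ω) δ η (Icc δ t)} := by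
    intro t δ x h0 hδ η
    subst hA hN hQ
    exact measure_lt_numberInSystem_le_upperBoundVar P hn lawA lawS hA_pos hS_pos hA_int hS_int U V σ
      hU_zero hU_succ hV_zero hV_succ hσ h_indep_renewal h_indep_queue h0 hδ η x
  refine ⟨fun t x _ _ => le_iInf₂ fun δ hδ => le_iInf₂ fun η _ => bound t δ x hδ.1 hδ.2 η, ?_⟩
  intro Ω' _ P' _ Qinf hlim x _
  refine le_iInf₂ fun δ hδ => le_iInf₂ fun η _ => ?_
  have hopen := ProbabilityMeasure.le_liminf_measure_open_of_tendsto hlim.tendsto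
    (isOpen_Ioi (a := x))
  have hlim_eq : P'.map Qinf (Ioi x) = P' {ω' | x < Qinf ω'} :=
    Measure.map_apply_of_aemeasurable hlim.aemeasurable_limit measurableSet_Ioi
  have hQ_eq : ∀ t, P.map (fun ω => (Q t ω : ℝ)) (Ioi x) = P {ω | x < (Q t ω : ℝ)} := fun t =>
    Measure.map_apply_of_aemeasurable (hlim.forall_aemeasurable t) measurableSet_Ioi
  simp only [ProbabilityMeasure.coe_mk, hlim_eq, hQ_eq] at hopen
  refine hopen.trans (liminf_le_of_frequently_le' (Eventually.frequently ?_))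
  filter_upwards [eventually_ge_atTop δ] with t ht
  refine (bound t δ x hδ ht η).trans (measure_mono fun ω hω => ?_)
  exact lt_of_lt_of_le hω (upperBoundVar_mono _ _ _ _ Icc_subset_Ici_self)
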